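/- **Setting.** Let $p,q\ge 1$ and let $\mathrm d\mu=(\mathrm d\mu_{b,a})$ be a $q\times p$ matrix of (real or complex) Borel measures on $\mathbb R$, all of whose moments converge absolutely, and let $\Delta$ be the union of the supports of its entries. For $r\in\mathbb N$ let $X_{[r]}(x)$ be the semi-infinite matrix with blocks $I_r,xI_r,x^2I_r,\dots$; the moment matrix of $\mu$ is $\mathscr M=\int X_{[q]}\,\mathrm d\mu\,X_{[p]}^\top$. Let $R(x)=\sum_{k=0}^{N^R}R_kx^k\in\mathbb C^{p\times p}[x]$ and $L(x)=\sum_{k=0}^{N^L}L_kx^k\in\mathbb C^{q\times q}[x]$ be matrix polynomials with, for some $0\le r<p$ and $0\le l<q$, $$R_{N^R}=\begin{bmatrix}0_{(p-r)\times r}&I_{p-r}\\0_{r\times r}&0_{r\times(p-r)}\end{bmatrix},\quad R_{N^R-1}=\begin{bmatrix}*&*\\I_r&*\end{bmatrix},\quad L_{N^L}=\begin{bmatrix}0_{l\times(q-l)}&0_{l\times l}\\I_{q-l}&0_{(q-l)\times l}\end{bmatrix},\quad L_{N^L-1}=\begin{bmatrix}*&I_l\\ *&*\end{bmatrix}.$$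 Put $M^R=N^Rp-r\ge0$ and $M^L=N^Lq-l\ge0$, the degrees of $\det R$ and $\det L$. Assume that $R$ has $M^R$ distinct eigenvalues $\rho_1,\dots,\rho_{M^R}$ and $L$ has $M^L$ distinct eigenvalues $\lambda_1,\dots,\lambda_{M^L}$ (so all eigenvalues, i.e. zeros of the determinants, are simple), and that no $\lambda_i$ lies in $\Delta$. Choose nonzero left eigenvectors $\overleftarrow r_kR(\rho_k)=0$, $\overleftarrow l_iL(\lambda_i)=0$ and nonzero right eigenvectors $L(\lambda_i)\vec l_i=0$, and let $\xi_i$ be arbitrary row-vector functions with $p$ entries. The perturbed matrix of linear functionals is $$\mathrm d\tilde\mu(x)=L(x)^{-1}\,\mathrm d\mu(x)\,R(x)+\sum_{i=1}^{M^L}\vec l_i\,\delta(x-\lambda_i)\,\xi_i(x)R(x),$$ where $\delta(x-\lambda_i)$ is evaluation at $\lambda_i\in\mathbb C$. Assume that the moment matrices of $\mu$ and $\tilde\mu$ have Gauss–Borel factorizations $\mathscr M=S^{-1}H\bar S^{-\top}$, $\tilde{\mathscr M}=\tilde S^{-1}\tilde H\tilde{\bar S}{}^{-\top}$, with $S,\bar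 S,\tilde S,\tilde{\bar S}$ lower unitriangular and $H,\tilde H$ invertible diagonal. Let $A_n(x)$ be the columns, $n\ge 0$, of $A=X_{[p]}^\top\bar S^\top$ and $B_n(x)$ the rows of $B=H^{-1}SX_{[q]}$, with entries $A_n^{(a)}$, $B_n^{(b)}$; define $\tilde A_n,\tilde B_n$ in the same way. Put $$C_n(z)=\int_\Delta\frac{\mathrm d\mu(x)}{z-x}A_n(x),\qquad K^{[n]}(x,y)=\sum_{j=0}^nA_j(x)B_j(y),\qquad K_C^{[n]}(x,y)=\sum_{j=0}^nC_j(x)B_j(y)$$ (the kernels are $0$ for $n=-1$), $c_i=\overleftarrow l_iL'(\lambda_i)\vec l_i$, and $$\mathbb A_n^{(k)}=\overleftarrow r_kA_n(\rho_k),\qquad \mathbb C_n^{(i)}=\overleftarrow l_iC_n(\lambda_i),\qquad \mathbb W_n^{(i)}=c_i\,\xi_i(\lambda_i)A_n(\lambda_i),$$ $$\mathbb K^{[n],(k)}(y)=\overleftarrow r_kK^{[n]}(\rho_k,y),\qquad \mathbb K_C^{[n],(i)}(y)=\overleftarrow l_iK_C^{[n]}(\lambda_i,y)-c_i\,\xi_i(\lambda_i)K^{[n]}(\lambda_i,y).$$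 Let $v_n\in\mathbb C^{M^R+M^L}$ be the column with entries $\mathbb A_n^{(1)},\dots,\mathbb A_n^{(M^R)},\mathbb C_n^{(1)}-\mathbb W_n^{(1)},\dots,\mathbb C_n^{(M^L)}-\mathbb W_n^{(M^L)}$, and let $\kappa_{n,b}(y)$ be the column with entries $\mathbb K_b^{[n],(k)}(y)$, $1\le k\le M^R$, followed by $\mathbb K_{C,b}^{[n],(i)}(y)+\dfrac{\overleftarrow l_{i,b}}{y-\lambda_i}$, $1\le i\le M^L$. **Theorem.** The functional $\tilde\mu$ satisfies $L(x)\,\mathrm d\tilde\mu(x)=\mathrm d\mu(x)\,R(x)$ on polynomials. For every $n\ge M^L$, $$\tau_n=\det\begin{bmatrix}v_{n-M^L}&\cdots&v_{n+M^R-1}\end{bmatrix}\ne0 ,$$ and the following formulas hold. If $n\ge1$ and $M^R+M^L\ge1$, then for $1\le b\le q$ and every $y\in\mathbb C\setminus\{\lambda_1,\dots,\lambda_{M^L}\}$, $$\tilde B_{n-1}^{(b)}(y)=-\sum_{\tilde b=1}^q\det\begin{bmatrix}v_{n-M^L}&\cdots&v_{n+M^R-2}&\kappa_{n-M^L-1,\tilde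 b}(y)\end{bmatrix}\frac{L_{\tilde b,b}(y)}{\tau_n}.$$ For $1\le a\le p$ and every $x\in\mathbb C\setminus\{\rho_1,\dots,\rho_{M^R}\}$, $$\tilde A_n^{(a)}(x)=\frac1{\tau_n}\sum_{\tilde a=1}^p\bigl(R(x)^{-1}\bigr)_{a,\tilde a}\det\begin{bmatrix}v_{n-M^L}&\cdots&v_{n+M^R}\\A^{(\tilde a)}_{n-M^L}(x)&\cdots&A^{(\tilde a)}_{n+M^R}(x)\end{bmatrix}.$$ -/

import Mathlib

open scoped Polynomial Matrix

noncomputable section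

namespace MixedMOP

/-! ### Matrices of measures, linear functionals, moments -/

/-- The integral `∫ f dc` of a complex function against a complex measure on the line. -/
def cint (c : MeasureTheory.ComplexMeasure ℝ) (f : ℝ → ℂ) : ℂ :=
  MeasureTheory.VectorMeasure.integral c f (ContinuousLinearMap.mul ℝ ℂ)

/-- A `q × p` matrix of (complex) Borel measures on the real line. -/
abbrev MatrixMeasure (q p : ℕ) : Type := Matrix (Fin q) (Fin p) (MeasureTheory.ComplexMeasure ℝ)

/-- The support `Δ`: the union of the supports of all the entries. -/
def MatrixMeasure.supp {q p : ℕ} (μ : MatrixMeasure q p) : Set ℝ :=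
  ⋃ b, ⋃ a, (μ b a).variation.support

/-- All the moments of all the entries exist (as absolutely convergent integrals). -/
def MatrixMeasure.HasMoments {q p : ℕ} (μ : MatrixMeasure q p) : Prop :=
  ∀ b a (k : ℕ), MeasureTheory.Integrable (fun x : ℝ => x ^ k) (μ b a).variation

/-- The linear functional `f ↦ ∫ f dμ`, with values in `q × p` matrices. -/
def MatrixMeasure.functional {q p : ℕ} (μ : MatrixMeasure q p) (f : ℂ → ℂ) :
    Matrix (Fin q) (Fin p) ℂ :=
  Matrix.of fun b a => cint (μ b a) (fun x => f x)

/-- The semi-infinite matrix of monomials, with blocks `I_r, x I_r, x² I_r, …`. -/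
def monomials (r : ℕ) (x : ℂ) : Matrix ℕ (Fin r) ℂ :=
  Matrix.of fun m b => if m % r = (b : ℕ) then x ^ (m / r) else 0

/-- The moment matrix `∫ X_[q](x) dμ(x) X_[p](x)ᵀ` of a `q × p` matrix of linear functionals. -/
def momentMatrix {q p : ℕ} (F : (ℂ → ℂ) → Matrix (Fin q) (Fin p) ℂ) : Matrix ℕ ℕ ℂ :=
  Matrix.of fun m n => ∑ b, ∑ a, F (fun x => monomials q x m b * monomials p x n a) b a

/-! ### Gauss–Borel factorization and the biorthogonal families -/

/-- The leading principal `k × k` submatrix. -/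
def leading (k : ℕ) (M : Matrix ℕ ℕ ℂ) : Matrix (Fin k) (Fin k) ℂ :=
  M.submatrix Fin.val Fin.val

/-- Lower unitriangular semi-infinite matrices. -/
def LowerUnitriangular (S : Matrix ℕ ℕ ℂ) : Prop :=
  (∀ n, S n n = 1) ∧ ∀ m n, m < n → S m n = 0

/-- The Gauss–Borel factorization `M = S⁻¹ H S̄⁻ᵀ`, with `S`, `S̄` lower unitriangular and `H` an
invertible diagonal matrix. As `S` and `S̄` are lower triangular, it amounts to
`S M S̄ᵀ = H` for all the leading principal submatrices. -/
structure IsGaussBorel (M S : Matrix ℕ ℕ ℂ) (H : ℕ → ℂ) (Sbar : Matrix ℕ ℕ ℂ) : Prop where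
  lower_left : LowerUnitriangular S
  lower_right : LowerUnitriangular Sbar
  diag_ne_zero : ∀ n, H n ≠ 0
  factorization : ∀ k, leading k S * leading k M * (leading k Sbar)ᵀ =
    Matrix.diagonal fun i : Fin k => H i

/-- The column vector `A_n(x)`, the `n`-th column of `X_[p](x)ᵀ S̄ᵀ`. -/
def polyA (p : ℕ) (Sbar : Matrix ℕ ℕ ℂ) (n : ℕ) (x : ℂ) : Fin p → ℂ :=
  fun a => ∑ j ∈ Finset.range (n + 1), Sbar n j * monomials p x j a

/-- The row vector `B_n(y)`, the `n`-th row of `H⁻¹ S X_[q](y)`. -/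
def polyB (q : ℕ) (S : Matrix ℕ ℕ ℂ) (H : ℕ → ℂ) (n : ℕ) (y : ℂ) : Fin q → ℂ :=
  fun b => (H n)⁻¹ * ∑ j ∈ Finset.range (n + 1), S n j * monomials q y j b

/-- The Cauchy transform `C_n(z) = ∫ dμ(x) A_n(x) / (z - x)`, a column vector. -/
def cauchyC {q p : ℕ} (μ : MatrixMeasure q p) (Sbar : Matrix ℕ ℕ ℂ) (n : ℕ) (z : ℂ) : Fin q → ℂ :=
  fun b => ∑ a, cint (μ b a) (fun x => polyA p Sbar n x a / (z - x))

/-- The Christoffel–Darboux kernel `K^{[m-1]}(x, y) = ∑_{i < m} A_i(x) B_i(y)` (zero for `m = 0`). -/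
def kernelK (q p : ℕ) (S : Matrix ℕ ℕ ℂ) (H : ℕ → ℂ) (Sbar : Matrix ℕ ℕ ℂ) (m : ℕ) (x y : ℂ) :
    Matrix (Fin p) (Fin q) ℂ :=
  ∑ i ∈ Finset.range m, Matrix.vecMulVec (polyA p Sbar i x) (polyB q S H i y)

/-- The mixed kernel `K_C^{[m-1]}(x, y) = ∑_{i < m} C_i(x) B_i(y)` (zero for `m = 0`). -/
def kernelKC {q p : ℕ} (μ : MatrixMeasure q p) (S : Matrix ℕ ℕ ℂ) (H : ℕ → ℂ)
    (Sbar : Matrix ℕ ℕ ℂ) (m : ℕ) (x y : ℂ) : Matrix (Fin q) (Fin q) ℂ :=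
  ∑ i ∈ Finset.range m, Matrix.vecMulVec (cauchyC μ Sbar i x) (polyB q S H i y)

/-! ### Matrix polynomials -/

/-- The value of a matrix polynomial at a point. -/
def evalAt {k : ℕ} (P : Matrix (Fin k) (Fin k) ℂ[X]) (x : ℂ) : Matrix (Fin k) (Fin k) ℂ :=
  P.map (Polynomial.eval x)

/-- The value of the derivative of a matrix polynomial at a point. -/
def derivAt {k : ℕ} (P : Matrix (Fin k) (Fin k) ℂ[X]) (x : ℂ) : Matrix (Fin k) (Fin k) ℂ :=
  P.map fun f => (Polynomial.derivative f).eval x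

/-- `R(x)` is a `p × p` matrix polynomial of degree `N` whose leading and subleading coefficients
have the block form
`R_N = [0_{(p-r)×r}, I_{p-r}; 0_{r×r}, 0_{r×(p-r)}]`, `R_{N-1} = [*, *; I_r, *]`. -/
structure RightNormalForm {p : ℕ} (R : Matrix (Fin p) (Fin p) ℂ[X]) (N r : ℕ) : Prop where
  lt : r < p
  coeff_gt : ∀ i j (k : ℕ), N < k → (R i j).coeff k = 0
  coeff_lead : ∀ i j : Fin p, (R i j).coeff N = if (j : ℕ) = r + i then 1 else 0
  coeff_sublead : ∀ k, k + 1 = N → ∀ i j : Fin p, p - r ≤ (i : ℕ) → (j : ℕ) < r →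
    (R i j).coeff k = if (i : ℕ) = (p - r) + j then 1 else 0

/-- `L(x)` is a `q × q` matrix polynomial of degree `N` whose leading and subleading coefficients
have the block form
`L_N = [0_{l×(q-l)}, 0_{l×l}; I_{q-l}, 0_{(q-l)×l}]`, `L_{N-1} = [*, I_l; *, *]`. -/
structure LeftNormalForm {q : ℕ} (L : Matrix (Fin q) (Fin q) ℂ[X]) (N l : ℕ) : Prop where
  lt : l < q
  coeff_gt : ∀ i j (k : ℕ), N < k → (L i j).coeff k = 0
  coeff_lead : ∀ i j : Fin q, (L i j).coeff N = if (i : ℕ) = l + j then 1 else 0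
  coeff_sublead : ∀ k, k + 1 = N → ∀ i j : Fin q, (i : ℕ) < l → q - l ≤ (j : ℕ) →
    (L i j).coeff k = if (j : ℕ) = (q - l) + i then 1 else 0

/-- The points `e 0, …, e (M - 1)` are distinct and they are exactly the eigenvalues of `P`. When
`M` is the degree of `det P`, this says that all the eigenvalues are simple. -/
def ListsEigenvalues {k M : ℕ} (P : Matrix (Fin k) (Fin k) ℂ[X]) (e : Fin M → ℂ) : Prop :=
  Function.Injective e ∧ ∀ z, (P.det).eval z = 0 ↔ ∃ i, e i = z

/-! ### The dual perturbation -/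

/-- The data of a dual perturbation with simple eigenvalues: the original matrix of measures `μ`,
the matrix polynomials `R` and `L`, their eigenvalues `rho` and `lam`, left eigenvectors
`rleft` of `R`, left and right eigenvectors `lleft` and `lright` of `L`, and the row vector
functions `xi` giving the masses at the eigenvalues of `L`. -/
structure DualData (q p MR ML : ℕ) where
  μ : MatrixMeasure q p
  R : Matrix (Fin p) (Fin p) ℂ[X]
  L : Matrix (Fin q) (Fin q) ℂ[X]
  rho : Fin MR → ℂ
  lam : Fin ML → ℂ
  rleft : Fin MR → Fin p → ℂ
  lleft : Fin ML → Fin q → ℂ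
  lright : Fin ML → Fin q → ℂ
  xi : Fin ML → ℂ → Fin p → ℂ

namespace DualData

variable {q p MR ML : ℕ} (D : DualData q p MR ML)

/-- The perturbed `q × p` matrix of linear functionals
`dμ̃(x) = L(x)⁻¹ dμ(x) R(x) + ∑_i l⃗_i δ(x - λ_i) ξ_i(x) R(x)`, as the map `f ↦ ∫ f dμ̃`. -/
def perturbed (f : ℂ → ℂ) : Matrix (Fin q) (Fin p) ℂ :=
  Matrix.of fun b a =>
    (∑ b', ∑ a', cint (D.μ b' a')
      (fun x => f x * (evalAt D.L x)⁻¹ b b' * evalAt D.R x a' a)) +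
    ∑ i, D.lright i b * f (D.lam i) * (D.xi i (D.lam i) ᵥ* evalAt D.R (D.lam i)) a

/-- `𝔸_n^{(k)} = r⃖_k A_n(ρ_k)`. -/
def valA (Sbar : Matrix ℕ ℕ ℂ) (n : ℕ) (k : Fin MR) : ℂ :=
  D.rleft k ⬝ᵥ polyA p Sbar n (D.rho k)

/-- `ℂ_n^{(i)} = l⃖_i C_n(λ_i)`, with `C_n` the Cauchy transform. -/
def valC (Sbar : Matrix ℕ ℕ ℂ) (n : ℕ) (i : Fin ML) : ℂ :=
  D.lleft i ⬝ᵥ cauchyC D.μ Sbar n (D.lam i)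

/-- The number `l⃖_i L'(λ_i) l⃗_i`. -/
def slope (i : Fin ML) : ℂ :=
  D.lleft i ⬝ᵥ (derivAt D.L (D.lam i) *ᵥ D.lright i)

/-- `𝕎_n^{(i)} = l⃖_i L'(λ_i) l⃗_i ξ_i(λ_i) A_n(λ_i)`. -/
def valW (Sbar : Matrix ℕ ℕ ℂ) (n : ℕ) (i : Fin ML) : ℂ :=
  D.slope i * (D.xi i (D.lam i) ⬝ᵥ polyA p Sbar n (D.lam i))

/-- The `b`-th entry of `𝕂^{[m-1],(k)}(y) = r⃖_k K^{[m-1]}(ρ_k, y)`. -/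
def kerA (S : Matrix ℕ ℕ ℂ) (H : ℕ → ℂ) (Sbar : Matrix ℕ ℕ ℂ) (m : ℕ) (y : ℂ) (b : Fin q)
    (k : Fin MR) : ℂ :=
  (D.rleft k ᵥ* kernelK q p S H Sbar m (D.rho k) y) b

/-- The `b`-th entry of
`𝕂_C^{[m-1],(i)}(y) = l⃖_i K_C^{[m-1]}(λ_i, y) - l⃖_i L'(λ_i) l⃗_i ξ_i(λ_i) K^{[m-1]}(λ_i, y)`. -/
def kerC (S : Matrix ℕ ℕ ℂ) (H : ℕ → ℂ) (Sbar : Matrix ℕ ℕ ℂ) (m : ℕ) (y : ℂ) (b : Fin q)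
    (i : Fin ML) : ℂ :=
  (D.lleft i ᵥ* kernelKC D.μ S H Sbar m (D.lam i) y) b -
    D.slope i * (D.xi i (D.lam i) ᵥ* kernelK q p S H Sbar m (D.lam i) y) b

/-- The column `(𝔸_n^{(1)}, …, 𝔸_n^{(M^R)}, ℂ_n^{(1)} - 𝕎_n^{(1)}, …, ℂ_n^{(M^L)} - 𝕎_n^{(M^L)})`. -/
def column (Sbar : Matrix ℕ ℕ ℂ) (n : ℕ) : Fin (MR + ML) → ℂ :=
  Fin.append (fun k => D.valA Sbar n k) (fun i => D.valC Sbar n i - D.valW Sbar n i)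

/-- The column with entries `𝕂_b^{[m-1],(k)}(y)`, for `k = 1, …, M^R`, followed by
`𝕂_{C,b}^{[m-1],(i)}(y) + l⃖_{i,b} / (y - λ_i)`, for `i = 1, …, M^L`. -/
def kernelColumn (S : Matrix ℕ ℕ ℂ) (H : ℕ → ℂ) (Sbar : Matrix ℕ ℕ ℂ) (m : ℕ) (y : ℂ)
    (b : Fin q) : Fin (MR + ML) → ℂ :=
  Fin.append (fun k => D.kerA S H Sbar m y b k)
    (fun i => D.kerC S H Sbar m y b i + D.lleft i b / (y - D.lam i))

/-- The determinant `τ_n` of the columns of indices `n - M^L, …, n + M^R - 1`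
(used for `n ≥ M^L`). -/
def tau (Sbar : Matrix ℕ ℕ ℂ) (n : ℕ) : ℂ :=
  (Matrix.of fun i j : Fin (MR + ML) => D.column Sbar (n - ML + j) i).det

/-- The determinant of the columns of indices `n - M^L, …, n + M^R - 2` followed by the kernel
column built on `K^{[n-M^L-1]}` and `K_C^{[n-M^L-1]}`
(used for `n ≥ M^L` and `M^R + M^L ≥ 1`). -/
def detB (S : Matrix ℕ ℕ ℂ) (H : ℕ → ℂ) (Sbar : Matrix ℕ ℕ ℂ) (n : ℕ) (y : ℂ) (b : Fin q) : ℂ :=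
  (Matrix.of fun i j : Fin (MR + ML) =>
    if (j : ℕ) + 1 = MR + ML then D.kernelColumn S H Sbar (n - ML) y b i
    else D.column Sbar (n - ML + j) i).det

/-- The determinant of the columns of indices `n - M^L, …, n + M^R`, bordered below by the row
`A_{n-M^L}^{(a)}(x), …, A_{n+M^R}^{(a)}(x)` (used for `n ≥ M^L`). -/
def detA (Sbar : Matrix ℕ ℕ ℂ) (n : ℕ) (x : ℂ) (a : Fin p) : ℂ :=
  (Matrix.of fun i j : Fin (MR + ML + 1) =>
    (Fin.snoc (α := fun _ => ℂ) (D.column Sbar (n - ML + j)) (polyA p Sbar (n - ML + j) x a) :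
      Fin (MR + ML + 1) → ℂ) i).det

end DualData

end MixedMOP

end

open MixedMOP

/-! Vectors of polynomials are filtered by the basis e_0, …, e_{p-1}, x e_0, …; "order below n"
means lying in the span of its first n vectors. With F(w, v) = ∫ w dμ v and F' the same form for μ̃,
a Gauss–Borel factorization says exactly that the B's and A's are triangular and biorthogonal, the
A's being monic (`IsGaussBorel.isBiorthogonal`). The normal forms of R and L make v ↦ Rv and w ↦ wL
raise orders by exactly M^R and M^L and preserve the top coefficient (`isMonicShift_mulVecMap`). The
relation L dμ̃ = dμ R becomes F'(wL, v) = F(w, Rv).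

The entries of v_n are values at A_n of functionals Φ. The first M^R, v ↦ r_k v(ρ_k), vanish on the
range of R, and being independent they cut out that range. The other M^L satisfy Φ_i(Rv) = F'(P_i,
v), where P_i = l_i L(x)/(λ_i - x) is a polynomial row of order below M^L
(`matrixForm_quotientRow`). The factor c_i in the mass term comes from P_i(λ_i) = -l_i L'(λ_i). The
P_i complement the range of L.

Put m = n - M^L. If a combination of A_m, …, A_{n+M^R-1} is killed by Φ, it equals Ru with u of
order below n. Then u is F'-orthogonal to all rows of order below n, because these are spanned by
the P_i and the wL with w of order below m. Biorthogonality for μ̃ gives u = 0, hence τ_n ≠ 0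
(`det_columnMatrix_ne_zero`).

For the right family, R Ã_n is a combination of A_m, …, A_{n+M^R} with last coefficient 1, and Φ
kills it. Cramer's rule then gives the bordered determinant (`det_bordered`). For the left family, a
combination of the P_i and the B_j L, j < m, with cofactors as coefficients is shown to pair with
vectors of order at most n - 1 as τ_n B̃_{n-1} does (`det_smul_left`). Evaluating it at y produces
the kernel column (`kernelColumn_eq`). -/

/-! ### Filtered linear algebra -/

namespace MixedMOP

section Filtration

variable {K V W : Type*} [Field K] [AddCommGroup V] [Module K V] [AddCommGroup W] [Module K W]

/-- The span of the first `n` vectors of a basis indexed by `ℕ`. -/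
def lowerPart (b : Module.Basis ℕ K V) (n : ℕ) : Submodule K V where
  carrier := {v | ∀ m, n ≤ m → b.repr v m = 0}
  add_mem' hu hv m hm := by simp [hu m hm, hv m hm]
  zero_mem' m _ := by simp
  smul_mem' c v hv m hm := by simp [hv m hm]

variable {b : Module.Basis ℕ K V} {bW : Module.Basis ℕ K W}

theorem mem_lowerPart {n : ℕ} {v : V} :
    v ∈ lowerPart b n ↔ ∀ m, n ≤ m → b.repr v m = 0 := Iff.rfl

theorem lowerPart_mono {m n : ℕ} (h : m ≤ n) : lowerPart b m ≤ lowerPart b n :=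
  fun _ hv k hk => hv k (h.trans hk)

theorem basis_mem_lowerPart {m n : ℕ} (h : m < n) : b m ∈ lowerPart b n := by
  intro k hk
  simp [show m ≠ k by omega]

theorem eq_zero_of_mem_lowerPart_zero {v : V} (hv : v ∈ lowerPart b 0) : v = 0 :=
  b.repr.map_eq_zero_iff.1 (Finsupp.ext fun m => hv m m.zero_le)

theorem exists_mem_lowerPart (b : Module.Basis ℕ K V) (v : V) : ∃ n, v ∈ lowerPart b n := by
  obtain ⟨n, hn⟩ := (b.repr v).support.exists_nat_subset_range
  refine ⟨n, fun m hm => ?_⟩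
  by_contra h
  have := hn (Finsupp.mem_support_iff.2 h)
  simp only [Finset.mem_range] at this
  omega

theorem mem_lowerPart_of_repr_eq_zero {n : ℕ} {v : V} (hv : v ∈ lowerPart b (n + 1))
    (h : b.repr v n = 0) : v ∈ lowerPart b n := by
  intro m hm
  rcases hm.eq_or_lt with rfl | hm
  · exact h
  · exact hv m hm

theorem sub_smul_mem_lowerPart {n : ℕ} {v a : V} (hv : v ∈ lowerPart b (n + 1))
    (ha : a ∈ lowerPart b (n + 1)) (h : b.repr a n = 1) :
    v - b.repr v n • a ∈ lowerPart b n :=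
  mem_lowerPart_of_repr_eq_zero (sub_mem hv (Submodule.smul_mem _ _ ha)) (by simp [h])

/-- A vector of `lowerPart b n` is expanded in any family that is triangular with respect to `b`,
with coefficients given by a dual family of functionals. -/
theorem eq_sum_of_mem_lowerPart {A : ℕ → V} {g : ℕ → V →ₗ[K] K}
    (hA : ∀ n, A n ∈ lowerPart b (n + 1)) (hlead : ∀ n, b.repr (A n) n ≠ 0)
    (hg : ∀ m n, g m (A n) = if m = n then 1 else 0) {n : ℕ} {v : V} (hv : v ∈ lowerPart b n) :
    v = ∑ j ∈ Finset.range n, g j v • A j := by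
  induction n generalizing v with
  | zero => simpa using eq_zero_of_mem_lowerPart_zero hv
  | succ n ih =>
    set c := b.repr v n / b.repr (A n) n with hc
    have hu : v - c • A n ∈ lowerPart b n :=
      mem_lowerPart_of_repr_eq_zero (sub_mem hv (Submodule.smul_mem _ _ (hA n)))
        (by simp [hc, hlead n])
    have h1 := ih hu
    -- The remainder involves only A_j with j < n, which g_n kills; hence g_n(v) is the quotient of
    -- the top coefficients.
    have hgn : g n (v - c • A n) = 0 := by
      rw [h1, map_sum]
      refine Finset.sum_eq_zero fun j hj => ?_
      have : n ≠ j := by simp only [Finset.mem_range] at hj; omega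
      simp [hg, this]
    have hcn : g n v = c := by
      have := hgn
      simp only [map_sub, map_smul, hg, if_true, smul_eq_mul, mul_one] at this
      exact sub_eq_zero.1 this
    rw [Finset.sum_range_succ, hcn, ← sub_eq_iff_eq_add]
    rw [h1]
    refine Finset.sum_congr rfl fun j hj => ?_
    have : j ≠ n := by simp only [Finset.mem_range] at hj; omega
    simp [hg, this]

/-! ### Monic shifts and division with remainder -/

/-- A linear map that raises the order of every basis vector by `M` and keeps it monic. -/
def IsMonicShift (b : Module.Basis ℕ K V) (M : ℕ) (T : V →ₗ[K] V) : Prop :=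
  ∀ n, T (b n) ∈ lowerPart b (n + M + 1) ∧ b.repr (T (b n)) (n + M) = 1

namespace IsMonicShift

variable {M : ℕ} {T : V →ₗ[K] V}

theorem map_mem (hT : IsMonicShift b M T) {n : ℕ} {v : V} (hv : v ∈ lowerPart b n) :
    T v ∈ lowerPart b (n + M) := by
  induction n generalizing v with
  | zero => simp [eq_zero_of_mem_lowerPart_zero hv]
  | succ n ih =>
    have h1 := ih (sub_smul_mem_lowerPart hv (basis_mem_lowerPart n.lt_succ_self) (by simp))
    rw [map_sub, map_smul] at h1
    have h2 : T v - b.repr v n • T (b n) + b.repr v n • T (b n) ∈ lowerPart b (n + 1 + M) :=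
      add_mem (lowerPart_mono (by omega) h1)
        (Submodule.smul_mem _ _ (lowerPart_mono (by omega) (hT n).1))
    simpa using h2

theorem repr_map (hT : IsMonicShift b M T) {n : ℕ} {v : V} (hv : v ∈ lowerPart b (n + 1)) :
    b.repr (T v) (n + M) = b.repr v n := by
  have h1 := hT.map_mem
    (sub_smul_mem_lowerPart hv (basis_mem_lowerPart n.lt_succ_self) (by simp)) (n + M) le_rfl
  rw [map_sub, map_smul, map_sub, map_smul, Finsupp.sub_apply, Finsupp.smul_apply, (hT n).2,
    smul_eq_mul, mul_one, sub_eq_zero] at h1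
  exact h1

/-- The top coefficient survives under T, so no cancellation can lower the order of the image; start
from any bound on the order of v and descend. -/
theorem mem_of_map_mem (hT : IsMonicShift b M T) {n : ℕ} {v : V}
    (hv : T v ∈ lowerPart b (n + M)) : v ∈ lowerPart b n := by
  obtain ⟨N, hN⟩ := exists_mem_lowerPart b v
  have key : ∀ k, v ∈ lowerPart b (n + k) → v ∈ lowerPart b n := by
    intro k
    induction k with
    | zero => exact id
    | succ k ih =>
      intro h
      exact ih (mem_lowerPart_of_repr_eq_zero h
        ((hT.repr_map h).symm.trans (hv (n + k + M) (by omega))))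
  exact key N (lowerPart_mono (by omega) hN)

theorem eq_zero_of_map (hT : IsMonicShift b M T) {v : V} (hv : T v = 0) : v = 0 :=
  eq_zero_of_mem_lowerPart_zero (hT.mem_of_map_mem (hv ▸ zero_mem _))

/-- Division with remainder by T: each step removes the top term with a multiple of the monic vector
T(b_n). -/
theorem exists_sub_mem (hT : IsMonicShift b M T) {n : ℕ} {v : V}
    (hv : v ∈ lowerPart b (n + M)) :
    ∃ u ∈ lowerPart b n, v - T u ∈ lowerPart b M := by
  induction n generalizing v with
  | zero => exact ⟨0, zero_mem _, by simpa using hv⟩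
  | succ n ih =>
    have hv' : v ∈ lowerPart b (n + M + 1) := by rwa [Nat.add_right_comm] at hv
    obtain ⟨u, hu, h⟩ := ih (sub_smul_mem_lowerPart hv' (hT n).1 (hT n).2)
    refine ⟨u + b.repr v (n + M) • b n, add_mem (lowerPart_mono n.le_succ hu)
      (Submodule.smul_mem _ _ (basis_mem_lowerPart n.lt_succ_self)), ?_⟩
    convert h using 1
    rw [map_add, map_smul]
    abel

end IsMonicShift

theorem sum_repr_of_mem_lowerPart {M : ℕ} {v : V} (hv : v ∈ lowerPart b M) :
    v = ∑ m : Fin M, b.repr v m • b m := by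
  rw [Fin.sum_univ_eq_sum_range (fun m => b.repr v m • b m)]
  exact eq_sum_of_mem_lowerPart (A := b) (g := fun m => b.coord m)
    (fun n => basis_mem_lowerPart n.lt_succ_self) (by simp)
    (fun m n => by simp [Finsupp.single_apply, eq_comm]) hv

/-- `M` functionals that are independent on an `M`-dimensional space have no common zero. -/
theorem eq_zero_of_functionals {M : ℕ} {φ : Fin M → V →ₗ[K] K}
    (hφ : ∀ β : Fin M → K, (∀ v ∈ lowerPart b M, ∑ k, β k * φ k v = 0) → β = 0)
    {v : V} (hv : v ∈ lowerPart b M) (h0 : ∀ k, φ k v = 0) : v = 0 := by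
  set X : Matrix (Fin M) (Fin M) K := Matrix.of fun k m => φ k (b m) with hX
  have hdet : X.det ≠ 0 := by
    intro h
    -- A left null vector of X is a linear relation between the functionals on `lowerPart b M`.
    obtain ⟨β, hβ, h⟩ := Matrix.exists_vecMul_eq_zero_iff.2 h
    refine hβ (hφ β fun v hv => ?_)
    rw [sum_repr_of_mem_lowerPart hv]
    simp only [map_sum, map_smul, smul_eq_mul, Finset.mul_sum]
    rw [Finset.sum_comm]
    refine Finset.sum_eq_zero fun m _ => ?_
    have := congrFun h m
    simp only [Matrix.vecMul, dotProduct, hX, Matrix.of_apply, Pi.zero_apply] at this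
    simp only [mul_left_comm _ (b.repr v _), ← Finset.mul_sum, this, mul_zero]
  have hz : (fun m : Fin M => b.repr v m) = 0 := by
    by_contra hne
    refine hdet (Matrix.exists_mulVec_eq_zero_iff.1 ⟨_, hne, funext fun k => ?_⟩)
    have := h0 k
    rw [sum_repr_of_mem_lowerPart hv] at this
    simp only [map_sum, map_smul, smul_eq_mul] at this
    simpa [Matrix.mulVec, dotProduct, hX, mul_comm] using this
  rw [sum_repr_of_mem_lowerPart hv]
  exact Finset.sum_eq_zero fun m _ => by rw [congrFun hz m]; simp

/-- `M` independent vectors of `lowerPart b M` span it. -/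
theorem exists_eq_sum_of_linearIndependent {M : ℕ} {P : Fin M → V}
    (hmem : ∀ i, P i ∈ lowerPart b M)
    (hP : ∀ β : Fin M → K, ∑ i, β i • P i = 0 → β = 0)
    {v : V} (hv : v ∈ lowerPart b M) : ∃ c : Fin M → K, v = ∑ i, c i • P i := by
  set X : Matrix (Fin M) (Fin M) K := Matrix.of fun i m => b.repr (P i) m with hX
  have hsum : ∀ c : Fin M → K, ∑ i, c i • P i = ∑ m : Fin M, (c ᵥ* X) m • b m := by
    intro c
    rw [sum_repr_of_mem_lowerPart (sum_mem fun i _ => Submodule.smul_mem _ (c i) (hmem i))]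
    refine Finset.sum_congr rfl fun m _ => ?_
    simp [Matrix.vecMul, dotProduct, hX, Finsupp.finsetSum_apply]
  have hdet : X.det ≠ 0 := by
    intro h
    obtain ⟨β, hβ, h⟩ := Matrix.exists_vecMul_eq_zero_iff.2 h
    exact hβ (hP β (by simp [hsum, h]))
  refine ⟨(fun m : Fin M => b.repr v m) ᵥ* X⁻¹, ?_⟩
  rw [hsum, Matrix.vecMul_vecMul, Matrix.nonsing_inv_mul _ (Ne.isUnit hdet), Matrix.vecMul_one]
  exact sum_repr_of_mem_lowerPart hv

/-! ### Biorthogonal families -/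

/-- Two triangular families, the second one monic, that are biorthogonal for a bilinear form. -/
structure IsBiorthogonal (bW : Module.Basis ℕ K W) (b : Module.Basis ℕ K V)
    (F : W →ₗ[K] V →ₗ[K] K) (B : ℕ → W) (A : ℕ → V) : Prop where
  left_mem : ∀ n, B n ∈ lowerPart bW (n + 1)
  left_lead : ∀ n, bW.repr (B n) n ≠ 0
  right_mem : ∀ n, A n ∈ lowerPart b (n + 1)
  right_lead : ∀ n, b.repr (A n) n = 1
  pairing : ∀ m n, F (B m) (A n) = if m = n then 1 else 0

namespace IsBiorthogonal

variable {F : W →ₗ[K] V →ₗ[K] K} {B : ℕ → W} {A : ℕ → V}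

theorem right_expand (h : IsBiorthogonal bW b F B A) {n : ℕ} {v : V}
    (hv : v ∈ lowerPart b n) : v = ∑ j ∈ Finset.range n, F (B j) v • A j :=
  eq_sum_of_mem_lowerPart (g := fun j => F (B j)) h.right_mem (by simp [h.right_lead])
    h.pairing hv

theorem left_expand (h : IsBiorthogonal bW b F B A) {n : ℕ} {w : W}
    (hw : w ∈ lowerPart bW n) : w = ∑ j ∈ Finset.range n, F w (A j) • B j :=
  eq_sum_of_mem_lowerPart (g := fun j => F.flip (A j)) h.left_mem h.left_lead
    (fun m n => by simp [h.pairing, eq_comm]) hw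

theorem right_orthogonal (h : IsBiorthogonal bW b F B A) {n : ℕ} {w : W}
    (hw : w ∈ lowerPart bW n) : F w (A n) = 0 := by
  rw [h.left_expand hw, map_sum, LinearMap.sum_apply]
  refine Finset.sum_eq_zero fun j hj => ?_
  have : j ≠ n := by simp only [Finset.mem_range] at hj; omega
  simp [h.pairing, this]

/-- In the expansion of v, only the monic A_n reaches the basis vector of index n, and its
coefficient is the pairing with B_n. -/
theorem pairing_eq_repr (h : IsBiorthogonal bW b F B A) {n : ℕ} {v : V}
    (hv : v ∈ lowerPart b (n + 1)) : F (B n) v = b.repr v n := by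
  have h1 := h.right_expand hv
  have h2 := congrArg (fun u => b.repr u n) h1
  simp only [Finset.sum_range_succ, map_add, map_sum, map_smul, Finsupp.add_apply,
    Finsupp.smul_apply, h.right_lead, smul_eq_mul, mul_one, Finsupp.finsetSum_apply] at h2
  rw [Finset.sum_eq_zero, zero_add] at h2
  · exact h2.symm
  · intro j hj
    simp only [Finset.mem_range] at hj
    rw [h.right_mem j n (by omega), mul_zero]

end IsBiorthogonal

end Filtration

end MixedMOP

/-! ### Christoffel formulas for a perturbed bilinear form -/

namespace MixedMOP

section Christoffel

variable {K V W : Type*} [Field K] [AddCommGroup V] [Module K V] [AddCommGroup W] [Module K W]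

/-- Two bilinear forms related by `F' (L w) v = F w (R v)`, with `R` and `L` monic shifts, and
functionals `Φ` whose first `MR` components determine the range of `R` and whose other `ML`
components are represented on it by vectors `P i` independent modulo the range of `L`. -/
structure IsDualPerturbation (bW : Module.Basis ℕ K W) (b : Module.Basis ℕ K V)
    (F F' : W →ₗ[K] V →ₗ[K] K) (MR ML : ℕ) (R : V →ₗ[K] V) (L : W →ₗ[K] W)
    (Φ : V →ₗ[K] Fin (MR + ML) → K) (P : Fin ML → W) : Prop where
  shift_right : IsMonicShift b MR R
  shift_left : IsMonicShift bW ML L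
  intertwine : ∀ w v, F' (L w) v = F w (R v)
  functional_right : ∀ v k, Φ (R v) (Fin.castAdd ML k) = 0
  functional_left : ∀ v i, Φ (R v) (Fin.natAdd MR i) = F' (P i) v
  functional_independent : ∀ β : Fin MR → K,
    (∀ v, ∑ k, β k * Φ v (Fin.castAdd ML k) = 0) → β = 0
  mem : ∀ i, P i ∈ lowerPart bW ML
  independent : ∀ β : Fin ML → K, ∑ i, β i • P i = 0 → β = 0

namespace IsDualPerturbation

variable {b : Module.Basis ℕ K V} {bW : Module.Basis ℕ K W} {F F' : W →ₗ[K] V →ₗ[K] K}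
  {MR ML : ℕ} {R : V →ₗ[K] V} {L : W →ₗ[K] W} {Φ : V →ₗ[K] Fin (MR + ML) → K} {P : Fin ML → W}
  {B B' : ℕ → W} {A A' : ℕ → V}

/-- Divide v by R: the remainder has order below M^R and is killed by M^R functionals that are
independent there, so it vanishes. -/
theorem exists_eq_map (h : IsDualPerturbation bW b F F' MR ML R L Φ P) {n : ℕ} {v : V}
    (hv : v ∈ lowerPart b (n + MR)) (h0 : ∀ k, Φ v (Fin.castAdd ML k) = 0) :
    ∃ u ∈ lowerPart b n, v = R u := by
  obtain ⟨u, hu, hs⟩ := h.shift_right.exists_sub_mem hv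
  refine ⟨u, hu, sub_eq_zero.1 ?_⟩
  refine eq_zero_of_functionals (φ := fun k => LinearMap.proj (Fin.castAdd ML k) ∘ₗ Φ) ?_ hs ?_
  · intro β hβ
    -- Independence on the whole space passes to the remainders, since the functionals vanish on the
    -- range of R.
    refine h.functional_independent β fun x => ?_
    obtain ⟨N, hN⟩ := exists_mem_lowerPart b x
    obtain ⟨y, -, hy⟩ := h.shift_right.exists_sub_mem (lowerPart_mono (Nat.le_add_right N MR) hN)
    have := hβ _ hy
    simpa [h.functional_right] using this
  · intro k
    simp [h.functional_right, h0]

theorem eq_zero_of_orthogonal (h : IsDualPerturbation bW b F F' MR ML R L Φ P)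
    (hb : IsBiorthogonal bW b F B A) (hb' : IsBiorthogonal bW b F' B' A') {m : ℕ} {v : V}
    (hv : v ∈ lowerPart b (m + ML + MR)) (horth : ∀ j < m, F (B j) v = 0) (h0 : Φ v = 0) :
    v = 0 := by
  obtain ⟨u, hu, rfl⟩ := h.exists_eq_map hv (by simp [h0])
  -- Write w = L x + ∑ c_i P_i with x of order below m. The first term pairs to F(x, R u), the
  -- others to components of Φ(R u), and all of these vanish.
  have key : ∀ w ∈ lowerPart bW (m + ML), F' w u = 0 := by
    intro w hw
    obtain ⟨x, hx, hs⟩ := h.shift_left.exists_sub_mem hw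
    obtain ⟨c, hc⟩ := exists_eq_sum_of_linearIndependent h.mem h.independent hs
    have hw' : w = L x + ∑ i, c i • P i := by rw [← hc]; abel
    have h1 : F x (R u) = 0 := by
      rw [hb.left_expand hx, map_sum, LinearMap.sum_apply]
      refine Finset.sum_eq_zero fun j hj => ?_
      simp [horth j (Finset.mem_range.1 hj)]
    rw [hw', map_add, LinearMap.add_apply, h.intertwine, h1, map_sum, LinearMap.sum_apply, zero_add]
    refine Finset.sum_eq_zero fun i _ => ?_
    simp [← h.functional_left, h0]
  have hu0 : u = 0 := by
    rw [hb'.right_expand hu]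
    refine Finset.sum_eq_zero fun j hj => ?_
    rw [key _ (lowerPart_mono (by simpa using hj) (hb'.left_mem j)), zero_smul]
  simp [hu0]

/-- The matrix with columns `Φ (A m), Φ (A (m + 1)), …`. -/
def columnMatrix (Φ : V →ₗ[K] Fin (MR + ML) → K) (A : ℕ → V) (m : ℕ) :
    Matrix (Fin (MR + ML)) (Fin (MR + ML)) K :=
  Matrix.of fun i j => Φ (A (m + j)) i

theorem det_columnMatrix_ne_zero (h : IsDualPerturbation bW b F F' MR ML R L Φ P)
    (hb : IsBiorthogonal bW b F B A) (hb' : IsBiorthogonal bW b F' B' A') (m : ℕ) :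
    (columnMatrix Φ A m).det ≠ 0 := by
  intro hdet
  obtain ⟨c, hc, hc0⟩ := Matrix.exists_mulVec_eq_zero_iff.2 hdet
  have hz : ∑ j, c j • A (m + j) = 0 := by
    refine h.eq_zero_of_orthogonal hb hb' (m := m) (sum_mem fun j _ => Submodule.smul_mem _ _
      (lowerPart_mono (by omega) (hb.right_mem _))) ?_ ?_
    · intro j hj
      rw [map_sum]
      refine Finset.sum_eq_zero fun i _ => ?_
      simp [hb.pairing, show j ≠ m + i by omega]
    · ext i
      have := congrFun hc0 i
      simpa [Matrix.mulVec, dotProduct, columnMatrix, mul_comm, Finset.sum_apply] using this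
  -- Pairing with B_{m+k} recovers the coefficient c_k of the vanishing combination.
  refine hc (funext fun k => ?_)
  have := congrArg (F (B (m + k))) hz
  simpa [map_sum, hb.pairing, Fin.val_inj] using this

/-- Cramer's rule in bordered form: since the last coefficient is 1, replacing the last column by X
c does not change the determinant, and the new column has only its bottom entry left. -/
theorem det_of_column_combination {N : ℕ} (X : Matrix (Fin (N + 1)) (Fin (N + 1)) K)
    (c : Fin (N + 1) → K) (hc : c (Fin.last N) = 1)
    (h0 : ∀ i : Fin N, (X *ᵥ c) i.castSucc = 0) :
    X.det = (X.submatrix Fin.castSucc Fin.castSucc).det * (X *ᵥ c) (Fin.last N) := by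
  have h1 := Matrix.det_updateCol_sum X (Fin.last N) c
  rw [hc, one_smul] at h1
  rw [← h1, Matrix.det_succ_column _ (Fin.last N), Fin.sum_univ_castSucc, Finset.sum_eq_zero]
  · have : (X.updateCol (Fin.last N) fun k => ∑ i, c i • X k i).submatrix
        (Fin.last N).succAbove (Fin.last N).succAbove
        = X.submatrix Fin.castSucc Fin.castSucc := by
      ext i j
      simp [(Fin.castSucc_lt_last j).ne]
    rw [this]
    have hs : ((-1 : K)) ^ (N + N) = 1 := by rw [← two_mul, pow_mul]; simp
    simp [hs, Matrix.mulVec, dotProduct, mul_comm]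
  · intro i _
    have := h0 i
    simp only [Matrix.mulVec, dotProduct] at this
    simp [mul_comm (c _), this]

/-- The Christoffel formula for the right family. -/
theorem det_bordered (h : IsDualPerturbation bW b F F' MR ML R L Φ P)
    (hb : IsBiorthogonal bW b F B A) (hb' : IsBiorthogonal bW b F' B' A') (m : ℕ)
    (ℓ : V →ₗ[K] K) :
    (Matrix.of fun i j : Fin (MR + ML + 1) =>
      (Fin.snoc (α := fun _ => K) (Φ (A (m + j))) (ℓ (A (m + j))) :
        Fin (MR + ML + 1) → K) i).det =
    (columnMatrix Φ A m).det * ℓ (R (A' (m + ML))) := by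
  set u := R (A' (m + ML)) with hu
  have hu_mem : u ∈ lowerPart b (m + (MR + ML + 1)) :=
    lowerPart_mono (by omega) (h.shift_right.map_mem (hb'.right_mem (m + ML)))
  have hexp : u = ∑ j : Fin (MR + ML + 1), F (B (m + j)) u • A (m + j) := by
    have h1 := hb.right_expand hu_mem
    rw [Finset.sum_range_add, Finset.sum_eq_zero, zero_add,
      ← Fin.sum_univ_eq_sum_range (fun j => F (B (m + j)) u • A (m + j))] at h1
    · exact h1
    · intro j hj
      simp only [Finset.mem_range] at hj
      -- F(B_j, R A') = F'(L B_j, A'), and for j < m the order of L B_j is at most the index m + M^L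
      -- of A'.
      have : F (B j) u = 0 := by
        rw [hu, ← h.intertwine]
        exact hb'.right_orthogonal (lowerPart_mono (by omega)
          (h.shift_left.map_mem (hb.left_mem j)))
      rw [this, zero_smul]
  have hlead : F (B (m + (MR + ML))) u = 1 := by
    rw [hb.pairing_eq_repr (n := m + (MR + ML)) hu_mem, hu, ← hb'.right_lead (m + ML),
      ← h.shift_right.repr_map (hb'.right_mem (m + ML))]
    congr 1
    omega
  have hΦ : Φ u = 0 := by
    ext i
    refine Fin.addCases (fun k => ?_) (fun k => ?_) i
    · exact h.functional_right _ _
    · rw [hu, h.functional_left]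
      exact hb'.right_orthogonal (lowerPart_mono (by omega) (h.mem k))
  have hmul : ∀ f : V →ₗ[K] K,
      ∑ j : Fin (MR + ML + 1), f (A (m + j)) * F (B (m + j)) u = f u := by
    intro f
    conv_rhs => rw [hexp]
    simp [map_sum, mul_comm]
  rw [det_of_column_combination _ (fun j => F (B (m + j)) u) (by simpa using hlead)]
  · congr 1
    · congr 1
      ext i j
      simp [columnMatrix]
    · simpa [Matrix.mulVec, dotProduct] using hmul ℓ
  · intro i
    have := hmul (LinearMap.proj i ∘ₗ Φ)
    simpa [Matrix.mulVec, dotProduct, hΦ] using this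

/-- The Christoffel formula for the left family. -/
theorem det_smul_left (h : IsDualPerturbation bW b F F' MR ML R L Φ P)
    (hb : IsBiorthogonal bW b F B A) (hb' : IsBiorthogonal bW b F' B' A') {m n : ℕ}
    (hn : n + 1 = m + ML) {t : Fin (MR + ML)} (ht : (t : ℕ) + 1 = MR + ML) :
    (columnMatrix Φ A m).det • B' n =
      ∑ i, (columnMatrix Φ A m).cramer (Pi.single (Fin.natAdd MR i) 1) t • P i -
      ∑ j ∈ Finset.range m, (columnMatrix Φ A m).cramer (Φ (A j)) t • L (B j) := by
  set X := columnMatrix Φ A m with hX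
  set G := ∑ i, X.cramer (Pi.single (Fin.natAdd MR i) 1) t • P i -
      ∑ j ∈ Finset.range m, X.cramer (Φ (A j)) t • L (B j) with hG
  have hGmem : G ∈ lowerPart bW (n + 1) := by
    refine sub_mem (sum_mem fun i _ => Submodule.smul_mem _ _ (lowerPart_mono (by omega) (h.mem i)))
      (sum_mem fun j hj => Submodule.smul_mem _ _ ?_)
    simp only [Finset.mem_range] at hj
    exact lowerPart_mono (by omega) (h.shift_left.map_mem (hb.left_mem j))
  -- The coefficients of G are chosen for this: on vectors of order at most n, the form F'(G, ·)
  -- reads only the top coefficient, as does that of a multiple of B'_n.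
  have hpair : ∀ v ∈ lowerPart b (n + 1), F' G v = b.repr v n * X.det := by
    intro v hv
    have hRv : R v ∈ lowerPart b (m + (MR + ML)) :=
      lowerPart_mono (by omega) (h.shift_right.map_mem hv)
    have h1 : ∑ i, X.cramer (Pi.single (Fin.natAdd MR i) 1) t * F' (P i) v =
        X.cramer (Φ (R v)) t := by
      conv_rhs => rw [pi_eq_sum_univ' (Φ (R v))]
      simp only [map_sum, map_smul, Finset.sum_apply, Pi.smul_apply, Fin.sum_univ_add,
        h.functional_right, h.functional_left, zero_smul, Finset.sum_const_zero, zero_add,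
        smul_eq_mul]
      exact Finset.sum_congr rfl fun i _ => mul_comm _ _
    -- Expand R v in the A_j. The terms j < m cancel against the second sum of G; for j ≥ m a column
    -- of X is inserted into slot t, which gives a repeated column unless it is column t itself.
    have h2 : X.cramer (Φ (R v)) t =
        ∑ j ∈ Finset.range m, X.cramer (Φ (A j)) t * F (B j) (R v) + b.repr v n * X.det := by
      conv_lhs => rw [hb.right_expand hRv, Finset.sum_range_add _ m (MR + ML)]
      simp only [map_add, map_sum, map_smul, Finset.sum_apply, Pi.add_apply, Pi.smul_apply,
        smul_eq_mul]
      congr 1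
      · exact Finset.sum_congr rfl fun j _ => mul_comm _ _
      · rw [Finset.sum_eq_single (t : ℕ)]
        · have e1 : F (B (m + t)) (R v) = b.repr v n := by
            rw [hb.pairing_eq_repr (lowerPart_mono (by omega) hRv), ← h.shift_right.repr_map hv]
            congr 1
            omega
          rw [e1, Matrix.cramer_apply]
          congr 2
          ext i j
          by_cases hj : j = t
          · subst hj; simp [hX, columnMatrix]
          · simp [hj]
        · intro j hj hjt
          simp only [Finset.mem_range] at hj
          have : X.cramer (Φ (A (m + j))) t = 0 := by
            rw [Matrix.cramer_apply]
            refine Matrix.det_zero_of_column_eq (i := t) (j := ⟨j, hj⟩)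
              (fun e => hjt (by rw [e])) fun k => ?_
            have hne : (⟨j, hj⟩ : Fin (MR + ML)) ≠ t := fun e => hjt (by rw [← e])
            simp [hne, hX, columnMatrix]
          rw [this, mul_zero]
        · intro ht'
          exact absurd (Finset.mem_range.2 t.2) ht'
    simp only [hG, map_sub, map_sum, map_smul, LinearMap.sub_apply, LinearMap.sum_apply,
      LinearMap.smul_apply, smul_eq_mul, h.intertwine]
    rw [h1, h2]
    ring
  rw [hb'.left_expand hGmem, Finset.sum_range_succ, Finset.sum_eq_zero, zero_add,
    hpair _ (hb'.right_mem n), hb'.right_lead, one_mul]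
  intro j hj
  simp only [Finset.mem_range] at hj
  rw [hpair _ (lowerPart_mono (by omega) (hb'.right_mem j)), hb'.right_mem j n (by omega), zero_mul,
    zero_smul]

end IsDualPerturbation

end Christoffel

end MixedMOP

/-! ### Vectors of polynomials -/

namespace MixedMOP

section PolynomialVectors

open Polynomial

/-- The basis `e_0, …, e_{p-1}, x e_0, …, x e_{p-1}, x² e_0, …` of the vectors of polynomials. -/
noncomputable def monomialBasis (p : ℕ) [NeZero p] : Module.Basis ℕ ℂ (Fin p → ℂ[X]) :=
  (Pi.basis fun _ : Fin p => Polynomial.basisMonomials ℂ).reindex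
    (((Equiv.sigmaEquivProd (Fin p) ℕ).trans (Equiv.prodComm _ _)).trans (Nat.divModEquiv p).symm)

/-- The evaluation of a vector of polynomials at a point. -/
noncomputable def evalVec {p : ℕ} (x : ℂ) : (Fin p → ℂ[X]) →ₗ[ℂ] (Fin p → ℂ) where
  toFun v a := (v a).eval x
  map_add' u v := by ext; simp
  map_smul' c v := by ext; simp

@[simp]
theorem evalVec_apply {p : ℕ} (x : ℂ) (v : Fin p → ℂ[X]) (a : Fin p) :
    evalVec x v a = (v a).eval x := rfl

section Basis

variable {p : ℕ} [NeZero p]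

theorem monomialBasis_apply (m : ℕ) :
    monomialBasis p m = Pi.single (Fin.ofNat p m) (X ^ (m / p)) := by
  simp [monomialBasis, Nat.divModEquiv, Polynomial.coe_basisMonomials, X_pow_eq_monomial]

theorem monomialBasis_repr (v : Fin p → ℂ[X]) (m : ℕ) :
    (monomialBasis p).repr v m = (v (Fin.ofNat p m)).coeff (m / p) := by
  simp only [monomialBasis, Module.Basis.repr_reindex, Finsupp.mapDomain_equiv_apply]
  exact Pi.basis_repr _ _ _

theorem evalVec_monomialBasis (m : ℕ) (x : ℂ) (a : Fin p) :
    evalVec x (monomialBasis p m) a = monomials p x m a := by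
  rw [evalVec_apply, monomialBasis_apply, monomials, Matrix.of_apply, Pi.single_apply]
  have : a = Fin.ofNat p m ↔ m % p = (a : ℕ) := by
    rw [Fin.ext_iff, Fin.val_ofNat, eq_comm]
  by_cases h : m % p = (a : ℕ)
  · rw [if_pos (this.2 h), if_pos h]; simp
  · rw [if_neg (mt this.1 h), if_neg h]; simp

theorem mem_lowerPart_monomialBasis {n : ℕ} {v : Fin p → ℂ[X]} :
    v ∈ lowerPart (monomialBasis p) n ↔
      ∀ (a : Fin p) (k : ℕ), n ≤ k * p + a → (v a).coeff k = 0 := by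
  rw [mem_lowerPart]
  constructor
  · intro h a k hk
    have := h _ hk
    rw [monomialBasis_repr] at this
    have h1 : (k * p + a) / p = k := by
      rw [mul_comm, Nat.mul_add_div (NeZero.pos p), Nat.div_eq_of_lt a.2, add_zero]
    have h2 : Fin.ofNat p (k * p + a) = a := by
      ext; rw [Fin.val_ofNat, Nat.mul_add_mod', Nat.mod_eq_of_lt a.2]
    rwa [h1, h2] at this
  · intro h m hm
    rw [monomialBasis_repr]
    refine h _ _ ?_
    rw [Fin.val_ofNat, Nat.div_add_mod']
    exact hm

end Basis

/-! ### Matrix polynomials in normal form as monic shifts -/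

/-- The multiplication of a vector of polynomials by a matrix polynomial. -/
noncomputable def mulVecMap {p : ℕ} (R : Matrix (Fin p) (Fin p) ℂ[X]) :
    (Fin p → ℂ[X]) →ₗ[ℂ] (Fin p → ℂ[X]) :=
  R.mulVecLin.restrictScalars ℂ

theorem mulVecMap_apply {p : ℕ} (R : Matrix (Fin p) (Fin p) ℂ[X]) (v : Fin p → ℂ[X]) :
    mulVecMap R v = R *ᵥ v := rfl

theorem evalVec_mulVec {p : ℕ} (R : Matrix (Fin p) (Fin p) ℂ[X]) (v : Fin p → ℂ[X]) (x : ℂ) :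
    evalVec x (R *ᵥ v) = evalAt R x *ᵥ evalVec x v := by
  ext a
  simp [Matrix.mulVec, dotProduct, evalAt, eval_finsetSum]

theorem evalVec_vecMul {p : ℕ} (L : Matrix (Fin p) (Fin p) ℂ[X]) (v : Fin p → ℂ[X]) (x : ℂ) :
    evalVec x (v ᵥ* L) = evalVec x v ᵥ* evalAt L x := by
  ext a
  simp [Matrix.vecMul, dotProduct, evalAt, eval_finsetSum]

theorem isMonicShift_mulVecMap {p N r M : ℕ} [NeZero p] {R : Matrix (Fin p) (Fin p) ℂ[X]}
    (hR : RightNormalForm R N r) (hM : M + r = N * p) :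
    IsMonicShift (monomialBasis p) M (mulVecMap R) := by
  intro n
  have key : ∀ m, n + M ≤ m → (monomialBasis p).repr (mulVecMap R (monomialBasis p n)) m =
      if m = n + M then 1 else 0 := by
    intro m hm
    rw [monomialBasis_repr, monomialBasis_apply, mulVecMap_apply, Matrix.mulVec_single]
    set i := Fin.ofNat p m with hi
    set j := Fin.ofNat p n with hj
    have hmi : m = m / p * p + i := by rw [hi, Fin.val_ofNat, Nat.div_add_mod']
    have hnj : n = n / p * p + j := by rw [hj, Fin.val_ofNat, Nat.div_add_mod']
    have hr := hR.lt
    have hi2 := i.2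
    have hj2 := j.2
    have hcoeff : ((MulOpposite.op (X ^ (n / p)) : ℂ[X]ᵐᵒᵖ) • R.col j) i =
        R i j * X ^ (n / p) := rfl
    rw [hcoeff, coeff_mul_X_pow']
    generalize m / p = k' at *
    generalize n / p = k at *
    have e : k * p + N * p = (k + N) * p := by ring
    -- At order n + M or above, r < p leaves only k' = k + N - 1 below the leading degree. Then i ≥
    -- p - r and j < r, which is exactly the prescribed block of the subleading coefficient.
    rcases lt_trichotomy k' (k + N) with h | h | h
    · have h1 : k' + 1 = k + N := by
        by_contra hne
        have : (k' + 2) * p ≤ (k + N) * p := Nat.mul_le_mul_right _ (by omega)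
        have e2 : (k' + 2) * p = k' * p + 2 * p := by ring
        omega
      have e2 : (k' + 1) * p = k' * p + p := by ring
      have e3 : k' * p + p = k * p + N * p := by rw [e, ← h1, e2]
      rcases N.eq_zero_or_pos with rfl | hN
      · simp only [zero_mul, add_zero] at *
        omega
      · rw [if_pos (by omega), hR.coeff_sublead (k' - k) (by omega) i j (by omega) (by omega)]
        exact if_congr (by omega) rfl rfl
    · subst h
      rw [if_pos (by omega), Nat.add_sub_cancel_left, hR.coeff_lead]
      exact if_congr (by omega) rfl rfl
    · have : (k + N + 1) * p ≤ k' * p := Nat.mul_le_mul_right _ h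
      have e2 : (k + N + 1) * p = (k + N) * p + p := by ring
      rw [if_pos (by omega), hR.coeff_gt _ _ _ (by omega), if_neg (by omega)]
  refine ⟨fun m hm => ?_, ?_⟩
  · rw [key m (by omega), if_neg (by omega)]
  · rw [key _ le_rfl, if_pos rfl]

theorem LeftNormalForm.transpose {q N l : ℕ} {L : Matrix (Fin q) (Fin q) ℂ[X]}
    (hL : LeftNormalForm L N l) : RightNormalForm Lᵀ N l :=
  ⟨hL.lt, fun i j => hL.coeff_gt j i, fun i j => hL.coeff_lead j i,
    fun k hk i j hi hj => hL.coeff_sublead k hk j i hj hi⟩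

/-- Scalar multiplication by X - z is the normal form with N = 1 and r = 0; division by X - z
therefore lowers orders by exactly p. -/
theorem isMonicShift_X_sub_C {p : ℕ} [NeZero p] (z : ℂ) :
    IsMonicShift (monomialBasis p) p
      (mulVecMap (Matrix.diagonal fun _ : Fin p => (X - C z : ℂ[X]))) := by
  refine isMonicShift_mulVecMap (N := 1) (r := 0) ⟨NeZero.pos p, fun i j k hk => ?_,
    fun i j => ?_, fun k _ i j _ hj => absurd hj (Nat.not_lt_zero _)⟩ (by simp)
  · rw [Matrix.diagonal_apply]
    split_ifs
    · simp [coeff_X, coeff_C, show 1 ≠ k by omega, show k ≠ 0 by omega]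
    · simp
  · rw [Matrix.diagonal_apply]
    simp only [zero_add, Fin.val_inj, eq_comm (a := j)]
    split_ifs <;> simp [coeff_X]

theorem mem_lowerPart_of_X_sub_C_mul {p : ℕ} [NeZero p] {n : ℕ} {z : ℂ} {v w : Fin p → ℂ[X]}
    (h : ∀ a, (X - C z) * v a = w a) (hw : w ∈ lowerPart (monomialBasis p) (n + p)) :
    v ∈ lowerPart (monomialBasis p) n := by
  refine (isMonicShift_X_sub_C z).mem_of_map_mem ?_
  convert hw using 1
  ext1 a
  rw [mulVecMap_apply, Matrix.mulVec_diagonal, h]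

theorem const_mem_lowerPart {p : ℕ} [NeZero p] (c : Fin p → ℂ) :
    (fun a => C (c a)) ∈ lowerPart (monomialBasis p) p := by
  rw [mem_lowerPart_monomialBasis]
  intro a k hk
  rw [coeff_C, if_neg]
  rintro rfl
  have := a.2
  omega

/-- Nonzero vectors attached to distinct points give independent functionals. -/
theorem functionals_independent {p M : ℕ} {e : Fin M → ℂ} (he : Function.Injective e)
    {c : Fin M → Fin p → ℂ} (hc : ∀ k, c k ≠ 0) {β : Fin M → ℂ}
    (h : ∀ v : Fin p → ℂ[X], ∑ k, β k * (c k ⬝ᵥ evalVec (e k) v) = 0) : β = 0 := by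
  ext k
  obtain ⟨a, ha⟩ := Function.ne_iff.1 (hc k)
  -- A Lagrange-type test vector: it vanishes at every e_j except e_k, in a coordinate a where c_k
  -- is nonzero.
  have h1 := h (Pi.single a (∏ j ∈ Finset.univ.erase k, (X - C (e j))))
  have hev : ∀ i, evalVec (e i) (Pi.single a (∏ j ∈ Finset.univ.erase k, (X - C (e j)))) =
      Pi.single a (∏ j ∈ Finset.univ.erase k, (e i - e j)) := by
    intro i
    ext a'
    rw [evalVec_apply, Pi.single_apply, Pi.single_apply]
    split_ifs <;> simp [eval_prod]
  simp only [hev, dotProduct_single] at h1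
  rw [Finset.sum_eq_single k] at h1
  · have h2 : ∏ j ∈ Finset.univ.erase k, (e k - e j) ≠ 0 :=
      Finset.prod_ne_zero_iff.2 fun j hj =>
        sub_ne_zero.2 fun h => (Finset.ne_of_mem_erase hj) (he h).symm
    simpa [h2, show c k a ≠ 0 from ha] using h1
  · intro i _ hik
    rw [Finset.prod_eq_zero (Finset.mem_erase.2 ⟨hik, Finset.mem_univ i⟩) (sub_self _)]
    simp
  · simp

/-! ### Row polynomials attached to the eigenvalues of L -/

/-- The row vector polynomial `c L(x) / (z - x)`, for `c L(z) = 0`. -/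
noncomputable def quotientRow {q : ℕ} (L : Matrix (Fin q) (Fin q) ℂ[X]) (z : ℂ) (c : Fin q → ℂ) :
    Fin q → ℂ[X] :=
  fun b => -(((fun a => C (c a)) ᵥ* L) b /ₘ (X - C z))

section QuotientRow

variable {q : ℕ} {L : Matrix (Fin q) (Fin q) ℂ[X]} {z : ℂ} {c : Fin q → ℂ}

theorem eval_constRow_vecMul (L : Matrix (Fin q) (Fin q) ℂ[X]) (c : Fin q → ℂ) (x : ℂ)
    (b : Fin q) : (((fun a => C (c a)) ᵥ* L) b).eval x = (c ᵥ* evalAt L x) b := by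
  rw [← evalVec_apply, evalVec_vecMul]
  congr
  ext
  simp

theorem X_sub_C_mul_quotientRow (h : c ᵥ* evalAt L z = 0) (b : Fin q) :
    (X - C z) * quotientRow L z c b = -((fun a => C (c a)) ᵥ* L) b := by
  rw [quotientRow, mul_neg, mul_divByMonic_eq_iff_isRoot.2]
  rw [IsRoot, eval_constRow_vecMul, h, Pi.zero_apply]

theorem evalVec_quotientRow (h : c ᵥ* evalAt L z = 0) {x : ℂ} (hx : x ≠ z) :
    evalVec x (quotientRow L z c) = (z - x)⁻¹ • (c ᵥ* evalAt L x) := by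
  ext b
  have h1 := congrArg (eval x) (X_sub_C_mul_quotientRow h b)
  rw [eval_neg, eval_constRow_vecMul, eval_mul, eval_sub, eval_X, eval_C] at h1
  have h2 : z - x ≠ 0 := sub_ne_zero.2 hx.symm
  rw [Pi.smul_apply, smul_eq_mul, eq_inv_mul_iff_mul_eq₀ h2, evalVec_apply]
  linear_combination -h1

/-- Differentiate (X - z) P = -c L and evaluate at z. -/
theorem evalVec_quotientRow_self (h : c ᵥ* evalAt L z = 0) :
    evalVec z (quotientRow L z c) = -(c ᵥ* derivAt L z) := by
  ext b
  have h1 := congrArg (fun f => eval z (derivative f)) (X_sub_C_mul_quotientRow h b)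
  simp only [derivative_mul, derivative_sub, derivative_X, derivative_C, sub_zero, one_mul,
    eval_add, eval_mul, eval_sub, eval_X, eval_C, sub_self, zero_mul, add_zero, derivative_neg,
    eval_neg] at h1
  rw [evalVec_apply, h1, Pi.neg_apply]
  simp [Matrix.vecMul, dotProduct, derivAt, eval_finsetSum]

theorem quotientRow_mem [NeZero q] {M : ℕ} (hL : IsMonicShift (monomialBasis q) M (mulVecMap Lᵀ))
    (h : c ᵥ* evalAt L z = 0) : quotientRow L z c ∈ lowerPart (monomialBasis q) M := by
  refine mem_lowerPart_of_X_sub_C_mul (X_sub_C_mul_quotientRow h) ?_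
  have := hL.map_mem (const_mem_lowerPart c)
  rw [mulVecMap_apply, Matrix.mulVec_transpose, add_comm] at this
  exact neg_mem this

/-- Multiplying a relation by ∏ (x - e_j) turns it into w L = 0 with w = ∑ β_i ∏_{j≠i} (x - e_j)
c_i. A monic shift is injective, so w = 0, and evaluation at e_k isolates β_k. -/
theorem quotientRow_independent [NeZero q] {N M : ℕ}
    (hL : IsMonicShift (monomialBasis q) N (mulVecMap Lᵀ))
    {e : Fin M → ℂ} (he : Function.Injective e) {c : Fin M → Fin q → ℂ} (hc : ∀ k, c k ≠ 0)
    (h : ∀ i, c i ᵥ* evalAt L (e i) = 0) {β : Fin M → ℂ}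
    (h0 : ∑ i, β i • quotientRow L (e i) (c i) = 0) : β = 0 := by
  set g : Fin M → ℂ[X] := fun i => ∏ j ∈ Finset.univ.erase i, (X - C (e j)) with hg
  have hw : ∑ i, (C (β i) * g i) • (fun a => C (c i a)) = (0 : Fin q → ℂ[X]) := by
    refine hL.eq_zero_of_map ?_
    rw [mulVecMap_apply, Matrix.mulVec_transpose]
    have h1 : ∀ i, (C (β i) * g i) • ((fun a => C (c i a)) ᵥ* L) =
        -((∏ j, (X - C (e j))) • β i • quotientRow L (e i) (c i)) := by
      intro i
      ext1 b
      have h2 := X_sub_C_mul_quotientRow (h i) b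
      simp only [Pi.smul_apply, Pi.neg_apply, smul_eq_mul, smul_eq_C_mul]
      rw [← Finset.mul_prod_erase _ _ (Finset.mem_univ i)]
      linear_combination (C (β i) * g i) * h2
    rw [Matrix.sum_vecMul]
    simp only [Matrix.smul_vecMul, h1, Finset.sum_neg_distrib, ← Finset.smul_sum, h0, smul_zero,
      neg_zero]
  ext k
  obtain ⟨a, ha⟩ := Function.ne_iff.1 (hc k)
  have h1 := congrArg (eval (e k)) (congrFun hw a)
  simp only [Finset.sum_apply, Pi.smul_apply, smul_eq_mul, eval_finsetSum, eval_mul, eval_C,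
    Pi.zero_apply, eval_zero, hg, eval_prod, eval_sub, eval_X] at h1
  rw [Finset.sum_eq_single k] at h1
  · have h2 : ∏ j ∈ Finset.univ.erase k, (e k - e j) ≠ 0 :=
      Finset.prod_ne_zero_iff.2 fun j hj =>
        sub_ne_zero.2 fun h => (Finset.ne_of_mem_erase hj) (he h).symm
    simpa [h2, show c k a ≠ 0 from ha] using h1
  · intro i _ hik
    rw [Finset.prod_eq_zero (Finset.mem_erase.2 ⟨hik.symm, Finset.mem_univ k⟩) (sub_self _)]
    simp
  · simp

end QuotientRow

end PolynomialVectors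

end MixedMOP

/-! ### Integrals against complex measures -/

namespace MixedMOP

section Integrals

open MeasureTheory Polynomial

/-- The pairing in `cint` is declared over ℝ; complex scalars still pull out because they pass
through the product of ℂ. -/
theorem cint_const_mul (c : ComplexMeasure ℝ) (k : ℂ) (f : ℝ → ℂ) :
    cint c (fun x => k * f x) = k * cint c f := by
  rw [cint, cint, VectorMeasure.integral, VectorMeasure.integral]
  exact setToFun_smul _ (fun k s x => by
    change k * x * _ = k * (x * _)
    ring) k f

theorem cint_sum {ι : Type*} (c : ComplexMeasure ℝ) (s : Finset ι) {f : ι → ℝ → ℂ}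
    (h : ∀ i ∈ s, Integrable (f i) c.variation) :
    cint c (fun x => ∑ i ∈ s, f i x) = ∑ i ∈ s, cint c (f i) :=
  VectorMeasure.integral_finsetSum s h

theorem cint_add (c : ComplexMeasure ℝ) {f g : ℝ → ℂ} (hf : Integrable f c.variation)
    (hg : Integrable g c.variation) :
    cint c (fun x => f x + g x) = cint c f + cint c g :=
  VectorMeasure.integral_fun_add hf hg

theorem cint_congr_of_eqOn {q p : ℕ} {μ : MatrixMeasure q p} {b : Fin q} {a : Fin p} {f g : ℝ → ℂ}
    (h : ∀ x ∈ μ.supp, f x = g x) : cint (μ b a) f = cint (μ b a) g := by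
  refine VectorMeasure.integral_congr_ae ?_
  filter_upwards [Measure.support_mem_ae (μ := (μ b a).variation)] with x hx
  exact h x (Set.mem_iUnion₂.2 ⟨b, a, hx⟩)

/-- The support is closed, so z has positive distance ε to it and the factor is bounded by 1/ε
almost everywhere. -/
theorem integrable_div_sub {ν : Measure ℝ} {f : ℝ → ℂ} (hf : Integrable f ν) {z : ℂ}
    (hz : ∀ x ∈ ν.support, z ≠ (x : ℂ)) : Integrable (fun x : ℝ => f x * (z - x)⁻¹) ν := by
  have hclosed : IsClosed ((fun x : ℝ => (x : ℂ)) '' ν.support) :=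
    Complex.isometry_ofReal.isClosedEmbedding.isClosedMap _ Measure.isClosed_support
  obtain ⟨ε, hε, hball⟩ := Metric.isOpen_iff.1 hclosed.isOpen_compl z (by
    rintro ⟨x, hx, rfl⟩
    exact hz x hx rfl)
  refine hf.mul_bdd (c := ε⁻¹) (by fun_prop) ?_
  filter_upwards [Measure.support_mem_ae (μ := ν)] with x hx
  rw [norm_inv]
  refine inv_anti₀ hε (le_of_not_gt fun hlt => ?_)
  refine hball (a := (x : ℂ)) ?_ ⟨x, hx, rfl⟩
  rw [Metric.mem_ball, dist_comm, dist_eq_norm]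
  exact hlt

theorem integrable_div_eval {ν : Measure ℝ} {f : ℝ → ℂ} (hf : Integrable f ν) {P : ℂ[X]}
    (hP : ∀ z, P.eval z = 0 → ∀ x ∈ ν.support, z ≠ (x : ℂ)) :
    Integrable (fun x : ℝ => f x * (P.eval (x : ℂ))⁻¹) ν := by
  -- For P = 0 the convention 0⁻¹ = 0 makes the integrand zero. Otherwise P splits over ℂ and its
  -- linear factors are divided out one at a time.
  rcases eq_or_ne P 0 with rfl | h0
  · simp
  have key : ∀ s : Multiset ℂ, (∀ z ∈ s, P.eval z = 0) →
      Integrable (fun x : ℝ => f x * ((s.map fun z => (x : ℂ) - z).prod)⁻¹) ν := by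
    intro s
    induction s using Multiset.induction_on with
    | empty => simpa using hf
    | cons z s ih =>
      intro h
      have h1 := integrable_div_sub (ih fun w hw => h w (Multiset.mem_cons_of_mem hw))
        (hP z (h z (Multiset.mem_cons_self z s)))
      convert h1.neg using 1
      ext x
      rw [Pi.neg_apply, Multiset.map_cons, Multiset.prod_cons, mul_inv, ← neg_sub z (x : ℂ), inv_neg]
      ring
  have h1 := (key P.roots fun z hz => (mem_roots h0).1 hz).mul_const P.leadingCoeff⁻¹
  convert h1 using 1
  ext x
  rw [(IsAlgClosed.splits P).eval_eq_prod_roots, mul_inv]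
  ring

theorem MatrixMeasure.HasMoments.integrable_eval {q p : ℕ} {μ : MatrixMeasure q p}
    (hμ : μ.HasMoments) (b : Fin q) (a : Fin p) (f : ℂ[X]) :
    Integrable (fun x : ℝ => f.eval (x : ℂ)) (μ b a).variation := by
  simp only [eval_eq_sum_range]
  refine integrable_finsetSum _ fun k _ => Integrable.const_mul ?_ _
  simpa using (hμ b a k).ofReal (𝕜 := ℂ)

/-- The linear functional `f ↦ ∫ f g dc` on polynomials. -/
noncomputable def weightedIntegral (c : ComplexMeasure ℝ) (g : ℝ → ℂ)
    (h : ∀ f : ℂ[X], Integrable (fun x : ℝ => f.eval (x : ℂ) * g x) c.variation) :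
    ℂ[X] →ₗ[ℂ] ℂ where
  toFun f := cint c (fun x => f.eval (x : ℂ) * g x)
  map_add' f₁ f₂ := by
    rw [← cint_add c (h f₁) (h f₂)]
    simp only [eval_add, add_mul]
  map_smul' k f := by
    simp only [eval_smul, smul_eq_mul, mul_assoc, cint_const_mul, RingHom.id_apply]

theorem weightedIntegral_apply {c : ComplexMeasure ℝ} {g : ℝ → ℂ}
    {h : ∀ f : ℂ[X], Integrable (fun x : ℝ => f.eval (x : ℂ) * g x) c.variation} (f : ℂ[X]) :
    weightedIntegral c g h f = cint c (fun x => f.eval (x : ℂ) * g x) := rfl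

theorem det_evalAt {k : ℕ} (L : Matrix (Fin k) (Fin k) ℂ[X]) (x : ℂ) :
    (evalAt L x).det = L.det.eval x :=
  ((evalRingHom x).map_det L).symm

theorem inv_evalAt_apply {k : ℕ} (L : Matrix (Fin k) (Fin k) ℂ[X]) (x : ℂ) (i j : Fin k) :
    (evalAt L x)⁻¹ i j = (L.adjugate i j).eval x * (L.det.eval x)⁻¹ := by
  have h : (evalAt L x).adjugate = evalAt L.adjugate x :=
    ((evalRingHom x).map_adjugate L).symm
  rw [Matrix.inv_def, Ring.inverse_eq_inv', det_evalAt, h, Matrix.smul_apply, smul_eq_mul, mul_comm]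
  rfl

end Integrals

/-! ### Matrices of functionals and Gauss–Borel factorizations -/

section MatrixForm

open Polynomial

variable {q p : ℕ}

/-- The bilinear form `(w, v) ↦ ∑ I b a (w b * v a)` given by a matrix of functionals. -/
noncomputable def matrixForm (I : Fin q → Fin p → ℂ[X] →ₗ[ℂ] ℂ) :
    (Fin q → ℂ[X]) →ₗ[ℂ] (Fin p → ℂ[X]) →ₗ[ℂ] ℂ :=
  ∑ b, ∑ a, ((LinearMap.mul ℂ ℂ[X]).compr₂ (I b a)).compl₁₂ (LinearMap.proj b) (LinearMap.proj a)

theorem matrixForm_apply (I : Fin q → Fin p → ℂ[X] →ₗ[ℂ] ℂ) (w : Fin q → ℂ[X])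
    (v : Fin p → ℂ[X]) : matrixForm I w v = ∑ b, ∑ a, I b a (w b * v a) := by
  simp [matrixForm, LinearMap.sum_apply]

theorem momentMatrix_eq_matrixForm [NeZero q] [NeZero p] {G : (ℂ → ℂ) → Matrix (Fin q) (Fin p) ℂ}
    {I : Fin q → Fin p → ℂ[X] →ₗ[ℂ] ℂ} (hG : ∀ f : ℂ[X], ∀ b a, G (fun x => f.eval x) b a = I b a f)
    (m n : ℕ) :
    momentMatrix G m n = matrixForm I (monomialBasis q m) (monomialBasis p n) := by
  rw [matrixForm_apply, momentMatrix, Matrix.of_apply]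
  refine Finset.sum_congr rfl fun b _ => Finset.sum_congr rfl fun a _ => ?_
  rw [← hG]
  congr 1
  ext x
  rw [eval_mul, ← evalVec_apply, ← evalVec_apply, evalVec_monomialBasis, evalVec_monomialBasis]

/-- The vectors of polynomials with the rows of `S` as coefficients. -/
noncomputable def rowFamily (p : ℕ) [NeZero p] (S : Matrix ℕ ℕ ℂ) (n : ℕ) : Fin p → ℂ[X] :=
  ∑ j ∈ Finset.range (n + 1), S n j • monomialBasis p j

theorem evalVec_rowFamily [NeZero p] (S : Matrix ℕ ℕ ℂ) (n : ℕ) (x : ℂ) :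
    evalVec x (rowFamily p S n) = polyA p S n x := by
  ext a
  simp only [rowFamily, map_sum, map_smul, Finset.sum_apply, Pi.smul_apply, evalVec_monomialBasis,
    polyA, smul_eq_mul]

theorem evalVec_smul_rowFamily [NeZero q] (S : Matrix ℕ ℕ ℂ) (H : ℕ → ℂ) (n : ℕ) (y : ℂ) :
    evalVec y ((H n)⁻¹ • rowFamily q S n) = polyB q S H n y := by
  rw [map_smul, evalVec_rowFamily]
  rfl

theorem rowFamily_mem [NeZero p] (S : Matrix ℕ ℕ ℂ) (n : ℕ) :
    rowFamily p S n ∈ lowerPart (monomialBasis p) (n + 1) :=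
  sum_mem fun _ hj => Submodule.smul_mem _ _ (basis_mem_lowerPart (Finset.mem_range.1 hj))

theorem repr_rowFamily [NeZero p] {S : Matrix ℕ ℕ ℂ} (hS : LowerUnitriangular S) (n : ℕ) :
    (monomialBasis p).repr (rowFamily p S n) n = 1 := by
  simp only [rowFamily, map_sum, map_smul, Module.Basis.repr_self, Finsupp.finsetSum_apply,
    Finsupp.smul_apply, Finsupp.single_apply, smul_eq_mul, mul_ite, mul_one, mul_zero]
  rw [Finset.sum_ite_eq' _ n, if_pos (by simp), hS.1]

theorem rowFamily_eq_sum_fin [NeZero p] {S : Matrix ℕ ℕ ℂ} (hS : LowerUnitriangular S) {n k : ℕ}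
    (h : n < k) : rowFamily p S n = ∑ j : Fin k, S n j • monomialBasis p j := by
  rw [Fin.sum_univ_eq_sum_range (fun j => S n j • monomialBasis p j), rowFamily]
  refine Finset.sum_subset (by simpa using h) fun j _ hj => ?_
  rw [hS.2 n j (by simpa using hj), zero_smul]

theorem IsGaussBorel.isBiorthogonal [NeZero q] [NeZero p]
    {G : (ℂ → ℂ) → Matrix (Fin q) (Fin p) ℂ} {I : Fin q → Fin p → ℂ[X] →ₗ[ℂ] ℂ}
    (hG : ∀ f : ℂ[X], ∀ b a, G (fun x => f.eval x) b a = I b a f) {S Sbar : Matrix ℕ ℕ ℂ}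
    {H : ℕ → ℂ} (h : IsGaussBorel (momentMatrix G) S H Sbar) :
    IsBiorthogonal (monomialBasis q) (monomialBasis p) (matrixForm I)
      (fun n => (H n)⁻¹ • rowFamily q S n) (rowFamily p Sbar) where
  left_mem n := Submodule.smul_mem _ _ (rowFamily_mem S n)
  left_lead n := by
    rw [map_smul, Finsupp.smul_apply, repr_rowFamily h.lower_left, smul_eq_mul, mul_one]
    exact inv_ne_zero (h.diag_ne_zero n)
  right_mem := rowFamily_mem Sbar
  right_lead := repr_rowFamily h.lower_right
  pairing m n := by
    have hm : m < m + n + 1 := by omega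
    have hn : n < m + n + 1 := by omega
    -- The leading block of size m + n + 1 contains both indices; its (m, n) entry is the pairing of
    -- the two rows.
    have h1 := congrFun₂ (h.factorization (m + n + 1)) ⟨m, hm⟩ ⟨n, hn⟩
    have h2 : matrixForm I (rowFamily q S m) (rowFamily p Sbar n) =
        if m = n then H m else 0 := by
      rw [rowFamily_eq_sum_fin h.lower_left hm, rowFamily_eq_sum_fin h.lower_right hn]
      rw [Matrix.diagonal_apply] at h1
      simp only [Fin.mk.injEq] at h1
      rw [← h1]
      simp only [Matrix.mul_apply, leading, Matrix.submatrix_apply, Matrix.transpose_apply, map_sum,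
        map_smul, LinearMap.sum_apply, LinearMap.smul_apply, smul_eq_mul,
        momentMatrix_eq_matrixForm hG, Finset.mul_sum, Finset.sum_mul]
      refine Finset.sum_congr rfl fun j _ => Finset.sum_congr rfl fun i _ => ?_
      ring
    rw [map_smul, LinearMap.smul_apply, h2, smul_eq_mul]
    split_ifs
    · exact inv_mul_cancel₀ (h.diag_ne_zero m)
    · exact mul_zero _

end MatrixForm

end MixedMOP

/-! ### The dual perturbation as a perturbed bilinear form -/

namespace MixedMOP

section Sums

theorem sum_comm_pairs {α β γ δ M : Type*} [Fintype α] [Fintype β] [Fintype γ] [Fintype δ]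
    [AddCommMonoid M] (f : α → β → γ → δ → M) :
    ∑ a, ∑ b, ∑ c, ∑ d, f a b c d = ∑ c, ∑ d, ∑ a, ∑ b, f a b c d := by
  simp only [← Fintype.sum_prod_type' (f := fun c d => f _ _ c d),
    ← Fintype.sum_prod_type' (f := fun a b => f a b _ _)]
  rw [← Fintype.sum_prod_type' (f := fun a b => ∑ x : γ × δ, f a b x.1 x.2), Finset.sum_comm,
    Fintype.sum_prod_type]

end Sums

namespace DualData

open MeasureTheory Polynomial

variable {q p MR ML : ℕ} (D : DualData q p MR ML)

/-- No eigenvalue of `L` lies in the support of the measures. -/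
def EigenvaluesOffSupport : Prop :=
  ∀ z, D.L.det.eval z = 0 → ∀ x ∈ D.μ.supp, z ≠ (x : ℂ)

variable {D}

theorem support_subset_supp (b : Fin q) (a : Fin p) : (D.μ b a).variation.support ⊆ D.μ.supp :=
  fun _ hx => Set.mem_iUnion₂.2 ⟨b, a, hx⟩

theorem integrable_perturbed (hμ : D.μ.HasMoments) (hoff : D.EigenvaluesOffSupport)
    (b' b : Fin q) (a' a : Fin p) (f : ℂ[X]) :
    Integrable (fun x : ℝ => f.eval (x : ℂ) * ((evalAt D.L x)⁻¹ b b' * evalAt D.R x a' a))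
      (D.μ b' a').variation := by
  have h := integrable_div_eval (P := D.L.det)
    (hμ.integrable_eval b' a' (f * D.L.adjugate b b' * D.R a' a))
    (fun z hz x hx => hoff z hz x (support_subset_supp b' a' hx))
  convert h using 1
  ext x
  rw [inv_evalAt_apply, eval_mul, eval_mul, evalAt, Matrix.map_apply]
  ring

theorem integrable_cauchy (hμ : D.μ.HasMoments) {z : ℂ} (hz : ∀ x ∈ D.μ.supp, z ≠ (x : ℂ))
    (b : Fin q) (a : Fin p) (f : ℂ[X]) :
    Integrable (fun x : ℝ => f.eval (x : ℂ) * (z - x)⁻¹) (D.μ b a).variation :=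
  integrable_div_sub (hμ.integrable_eval b a f) fun x hx => hz x (support_subset_supp b a hx)

theorem exists_functional (hμ : D.μ.HasMoments) :
    ∃ I : Fin q → Fin p → ℂ[X] →ₗ[ℂ] ℂ,
      ∀ f : ℂ[X], ∀ b a, D.μ.functional (fun x => f.eval x) b a = I b a f := by
  refine ⟨fun b a => weightedIntegral (D.μ b a) (fun _ => 1)
    (by simpa using hμ.integrable_eval b a), fun f b a => ?_⟩
  rw [weightedIntegral_apply, MatrixMeasure.functional, Matrix.of_apply]
  simp only [mul_one]

theorem exists_perturbed (hμ : D.μ.HasMoments) (hoff : D.EigenvaluesOffSupport) :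
    ∃ I : Fin q → Fin p → ℂ[X] →ₗ[ℂ] ℂ,
      ∀ f : ℂ[X], ∀ b a, D.perturbed (fun x => f.eval x) b a = I b a f := by
  refine ⟨fun b a => ∑ b', ∑ a', weightedIntegral (D.μ b' a') _
      (integrable_perturbed hμ hoff b' b a' a) +
    ∑ i, (D.lright i b * (D.xi i (D.lam i) ᵥ* evalAt D.R (D.lam i)) a) • leval (D.lam i),
    fun f b a => ?_⟩
  simp only [LinearMap.add_apply, LinearMap.sum_apply, weightedIntegral_apply,
    LinearMap.smul_apply, leval_apply, smul_eq_mul, perturbed, Matrix.of_apply, mul_assoc]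
  congr 1
  exact Finset.sum_congr rfl fun i _ => by ring

theorem matrixForm_functional {I : Fin q → Fin p → ℂ[X] →ₗ[ℂ] ℂ}
    (hI : ∀ f : ℂ[X], ∀ b a, D.μ.functional (fun x => f.eval x) b a = I b a f)
    (w : Fin q → ℂ[X]) (v : Fin p → ℂ[X]) :
    matrixForm I w v =
      ∑ b, ∑ a, cint (D.μ b a) (fun x : ℝ => evalVec (x : ℂ) w b * evalVec (x : ℂ) v a) := by
  simp only [matrixForm_apply, ← hI, MatrixMeasure.functional, Matrix.of_apply, eval_mul,
    evalVec_apply]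

/-- This form moves L⁻¹ onto the row w and R onto the column v, so that w can absorb L⁻¹ when it is
a multiple of L. -/
theorem matrixForm_perturbed (hμ : D.μ.HasMoments) (hoff : D.EigenvaluesOffSupport)
    {I : Fin q → Fin p → ℂ[X] →ₗ[ℂ] ℂ}
    (hI : ∀ f : ℂ[X], ∀ b a, D.perturbed (fun x => f.eval x) b a = I b a f)
    (w : Fin q → ℂ[X]) (v : Fin p → ℂ[X]) :
    matrixForm I w v =
      ∑ b, ∑ a, cint (D.μ b a) (fun x : ℝ =>
        (evalVec (x : ℂ) w ᵥ* (evalAt D.L x)⁻¹) b * evalVec (x : ℂ) (D.R *ᵥ v) a) +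
      ∑ i, (evalVec (D.lam i) w ⬝ᵥ D.lright i) *
        (D.xi i (D.lam i) ⬝ᵥ evalVec (D.lam i) (D.R *ᵥ v)) := by
  simp only [matrixForm_apply, ← hI, perturbed, Matrix.of_apply, eval_mul, Finset.sum_add_distrib]
  congr 1
  · rw [sum_comm_pairs]
    refine Finset.sum_congr rfl fun b' _ => Finset.sum_congr rfl fun a' _ => ?_
    have hint : ∀ b a, Integrable (fun x : ℝ => (w b).eval (x : ℂ) * (v a).eval (x : ℂ) *
        (evalAt D.L x)⁻¹ b b' * evalAt D.R x a' a) (D.μ b' a').variation := by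
      intro b a
      simpa only [eval_mul, mul_assoc] using integrable_perturbed hμ hoff b' b a' a (w b * v a)
    simp only [← cint_sum _ _ fun a _ => hint _ a]
    rw [← cint_sum _ _ fun b _ => integrable_finsetSum _ fun a _ => hint b a]
    congr 1
    ext x
    rw [evalVec_mulVec]
    simp only [Matrix.vecMul, Matrix.mulVec, dotProduct, evalVec_apply, Finset.sum_mul_sum]
    exact Finset.sum_congr rfl fun b _ => Finset.sum_congr rfl fun a _ => by ring
  · simp only [evalVec_mulVec, Matrix.dotProduct_mulVec]
    simp only [dotProduct, evalVec_apply, Finset.sum_mul_sum]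
    rw [Finset.sum_congr rfl fun _ _ => Finset.sum_comm, Finset.sum_comm]
    exact Finset.sum_congr rfl fun i _ => Finset.sum_congr rfl fun b _ =>
      Finset.sum_congr rfl fun a _ => by ring

/-- The relation `L dμ̃ = dμ R` in terms of bilinear forms. -/
theorem matrixForm_intertwine (hμ : D.μ.HasMoments) (hoff : D.EigenvaluesOffSupport)
    (hright : ∀ i, evalAt D.L (D.lam i) *ᵥ D.lright i = 0)
    {I I' : Fin q → Fin p → ℂ[X] →ₗ[ℂ] ℂ}
    (hI : ∀ f : ℂ[X], ∀ b a, D.μ.functional (fun x => f.eval x) b a = I b a f)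
    (hI' : ∀ f : ℂ[X], ∀ b a, D.perturbed (fun x => f.eval x) b a = I' b a f)
    (w : Fin q → ℂ[X]) (v : Fin p → ℂ[X]) :
    matrixForm I' (mulVecMap D.Lᵀ w) v = matrixForm I w (mulVecMap D.R v) := by
  rw [matrixForm_perturbed hμ hoff hI', matrixForm_functional hI, mulVecMap_apply, mulVecMap_apply,
    Matrix.mulVec_transpose]
  -- The masses disappear since L(λ_i) kills the right eigenvector; in the integrals L L⁻¹ = 1 is
  -- needed only on the support, where det L has no zero.
  rw [Finset.sum_eq_zero (s := Finset.univ) (f := fun i => _ * _), add_zero]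
  · refine Finset.sum_congr rfl fun b _ => Finset.sum_congr rfl fun a _ => ?_
    refine cint_congr_of_eqOn fun x hx => ?_
    have hu : IsUnit (evalAt D.L (x : ℂ)).det := by
      rw [det_evalAt, isUnit_iff_ne_zero]
      exact fun h => hoff _ h x hx rfl
    rw [evalVec_vecMul, Matrix.vecMul_vecMul, Matrix.mul_nonsing_inv _ hu, Matrix.vecMul_one]
  · intro i _
    rw [evalVec_vecMul, ← Matrix.dotProduct_mulVec, hright, dotProduct_zero, zero_mul]

theorem perturbed_relation (hμ : D.μ.HasMoments) (hoff : D.EigenvaluesOffSupport)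
    (hright : ∀ i, evalAt D.L (D.lam i) *ᵥ D.lright i = 0)
    (f : ℂ[X]) (b : Fin q) (a : Fin p) :
    ∑ b', D.perturbed (fun x => (D.L b b').eval x * f.eval x) b' a =
      ∑ a', D.μ.functional (fun x => f.eval x * (D.R a' a).eval x) b a' := by
  obtain ⟨I, hI⟩ := exists_functional hμ
  obtain ⟨I', hI'⟩ := exists_perturbed hμ hoff
  -- The entry (b, a) of the relation is the intertwining identity tested on f e_b and e_a.
  have h := matrixForm_intertwine hμ hoff hright hI hI' (Pi.single b f) (Pi.single a 1)
  have e1 : ∀ b', D.perturbed (fun x => (D.L b b').eval x * f.eval x) b' a =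
      I' b' a (D.L b b' * f) := by
    intro b'
    rw [← hI']
    simp only [eval_mul]
  have e2 : ∀ a', D.μ.functional (fun x => f.eval x * (D.R a' a).eval x) b a' =
      I b a' (f * D.R a' a) := by
    intro a'
    rw [← hI]
    simp only [eval_mul]
  simp only [e1, e2]
  rw [matrixForm_apply, matrixForm_apply, mulVecMap_apply, mulVecMap_apply] at h
  refine Eq.trans (Finset.sum_congr rfl fun b' _ => ?_)
    (h.trans ((Finset.sum_eq_single b (fun b' _ hb' => by simp [hb']) (by simp)).trans
      (Finset.sum_congr rfl fun a' _ => ?_)))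
  · rw [Finset.sum_eq_single a (fun a' _ ha' => by simp [ha']) (by simp)]
    simp
  · simp

/-- The functionals `v ↦ r⃖_k v(ρ_k)` and
`v ↦ l⃖_i ∫ dμ v / (λ_i - x) - l⃖_i L'(λ_i) l⃗_i ξ_i(λ_i) v(λ_i)`. -/
theorem exists_column (hμ : D.μ.HasMoments) (hΔ : ∀ i, ∀ x ∈ D.μ.supp, D.lam i ≠ (x : ℂ)) :
    ∃ Φ : (Fin p → ℂ[X]) →ₗ[ℂ] Fin (MR + ML) → ℂ, ∀ v,
      Φ v = Fin.append (fun k => D.rleft k ⬝ᵥ evalVec (D.rho k) v)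
        (fun i => D.lleft i ⬝ᵥ (fun b => ∑ a, cint (D.μ b a)
            (fun x : ℝ => evalVec (x : ℂ) v a / (D.lam i - x))) -
          D.slope i * (D.xi i (D.lam i) ⬝ᵥ evalVec (D.lam i) v)) := by
  refine ⟨LinearMap.pi (Fin.append
    (fun k => ∑ a, D.rleft k a • LinearMap.proj a ∘ₗ evalVec (D.rho k))
    (fun i => ∑ b, D.lleft i b • ∑ a, weightedIntegral (D.μ b a) _
        (integrable_cauchy hμ (hΔ i) b a) ∘ₗ LinearMap.proj a -
      D.slope i • ∑ a, D.xi i (D.lam i) a • LinearMap.proj a ∘ₗ evalVec (D.lam i))),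
    fun v => ?_⟩
  ext j
  refine Fin.addCases (fun k => ?_) (fun i => ?_) j
  · simp [dotProduct]
  · simp [dotProduct, weightedIntegral_apply, div_eq_mul_inv]

theorem column_eq [NeZero p] {Φ : (Fin p → ℂ[X]) →ₗ[ℂ] Fin (MR + ML) → ℂ}
    (hΦ : ∀ v, Φ v = Fin.append (fun k => D.rleft k ⬝ᵥ evalVec (D.rho k) v)
        (fun i => D.lleft i ⬝ᵥ (fun b => ∑ a, cint (D.μ b a)
            (fun x : ℝ => evalVec (x : ℂ) v a / (D.lam i - x))) -
          D.slope i * (D.xi i (D.lam i) ⬝ᵥ evalVec (D.lam i) v)))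
    (Sbar : Matrix ℕ ℕ ℂ) (n : ℕ) : Φ (rowFamily p Sbar n) = D.column Sbar n := by
  rw [hΦ]
  simp only [evalVec_rowFamily]
  rfl

/-- The functional attached to an eigenvalue of `L` is represented by `l⃖_i L(x) / (λ_i - x)`. -/
theorem matrixForm_quotientRow (hμ : D.μ.HasMoments) (hoff : D.EigenvaluesOffSupport)
    (hΔ : ∀ i, ∀ x ∈ D.μ.supp, D.lam i ≠ (x : ℂ)) (hlam : Function.Injective D.lam)
    (hleft : ∀ i, D.lleft i ᵥ* evalAt D.L (D.lam i) = 0)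
    (hright : ∀ i, evalAt D.L (D.lam i) *ᵥ D.lright i = 0)
    {I' : Fin q → Fin p → ℂ[X] →ₗ[ℂ] ℂ}
    (hI' : ∀ f : ℂ[X], ∀ b a, D.perturbed (fun x => f.eval x) b a = I' b a f)
    (i : Fin ML) (v : Fin p → ℂ[X]) :
    matrixForm I' (quotientRow D.L (D.lam i) (D.lleft i)) v =
      D.lleft i ⬝ᵥ (fun b => ∑ a, cint (D.μ b a)
          (fun x : ℝ => evalVec (x : ℂ) (D.R *ᵥ v) a / (D.lam i - x))) -
        D.slope i * (D.xi i (D.lam i) ⬝ᵥ evalVec (D.lam i) (D.R *ᵥ v)) := by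
  rw [matrixForm_perturbed hμ hoff hI', sub_eq_add_neg]
  congr 1
  · rw [dotProduct]
    refine Finset.sum_congr rfl fun b _ => ?_
    rw [Finset.mul_sum]
    refine Finset.sum_congr rfl fun a _ => ?_
    rw [← cint_const_mul]
    refine cint_congr_of_eqOn fun x hx => ?_
    have hu : IsUnit (evalAt D.L (x : ℂ)).det := by
      rw [det_evalAt, isUnit_iff_ne_zero]
      exact fun h => hoff _ h x hx rfl
    rw [evalVec_quotientRow (hleft i) (hΔ i x hx).symm, Matrix.smul_vecMul, Matrix.vecMul_vecMul,
      Matrix.mul_nonsing_inv _ hu, Matrix.vecMul_one, Pi.smul_apply, smul_eq_mul]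
    ring
  -- Only the mass at λ_i survives: at λ_j with j ≠ i the row is proportional to l_i L(λ_j), which
  -- kills the right eigenvector, while at λ_i its value is -l_i L'(λ_i).
  · rw [Finset.sum_eq_single i]
    · rw [evalVec_quotientRow_self (hleft i), neg_dotProduct, ← Matrix.dotProduct_mulVec, slope,
        neg_mul]
    · intro j _ hj
      rw [evalVec_quotientRow (hleft i) (hlam.ne hj), smul_dotProduct, ← Matrix.dotProduct_mulVec,
        hright, dotProduct_zero, smul_zero, zero_mul]
    · simp

/-- Separates the kernel part, a combination of earlier columns, from the Cauchy terms on coordinate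
vectors. By linearity of `cramer`, these match the two sums in `det_smul_left`. -/
theorem kernelColumn_eq (S : Matrix ℕ ℕ ℂ) (H : ℕ → ℂ) (Sbar : Matrix ℕ ℕ ℂ) (m : ℕ) (y : ℂ)
    (b : Fin q) :
    D.kernelColumn S H Sbar m y b =
      ∑ j ∈ Finset.range m, polyB q S H j y b • D.column Sbar j +
      ∑ i, (D.lleft i b / (y - D.lam i)) • Pi.single (Fin.natAdd MR i) 1 := by
  have hK : ∀ {k : ℕ} (c : Fin k → ℂ) (g : ℕ → Fin k → ℂ),
      (c ᵥ* ∑ j ∈ Finset.range m, Matrix.vecMulVec (g j) (polyB q S H j y)) b =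
        ∑ j ∈ Finset.range m, polyB q S H j y b * (c ⬝ᵥ g j) := by
    intro k c g
    rw [Matrix.vecMul_sum, Finset.sum_apply]
    refine Finset.sum_congr rfl fun j _ => ?_
    rw [Matrix.vecMul_vecMulVec]
    simp [mul_comm]
  ext j
  simp only [Pi.add_apply, Finset.sum_apply, Pi.smul_apply, smul_eq_mul]
  refine Fin.addCases (fun k => ?_) (fun i => ?_) j
  · rw [Finset.sum_eq_zero (s := (Finset.univ : Finset (Fin ML)))]
    · simp [kernelColumn, column, kerA, kernelK, hK, valA]
    · intro i _
      rw [Pi.single_eq_of_ne, mul_zero]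
      simp [Fin.ext_iff]
      omega
  · rw [Finset.sum_eq_single (a := i) (s := (Finset.univ : Finset (Fin ML)))]
    · simp [kernelColumn, column, kerC, kernelK, kernelKC, hK, valC, valW, mul_sub,
        Finset.sum_sub_distrib, Finset.mul_sum, mul_left_comm]
    · intro i' _ hi
      rw [Pi.single_eq_of_ne, mul_zero]
      simpa [Fin.ext_iff, eq_comm] using hi
    · simp

end DualData

end MixedMOP

/-! ### The Christoffel formulas -/

namespace MixedMOP

namespace DualData

open Polynomial

variable {q p MR ML : ℕ} {D : DualData q p MR ML}

theorem detB_eq_cramer (S : Matrix ℕ ℕ ℂ) (H : ℕ → ℂ) (Sbar : Matrix ℕ ℕ ℂ) (n : ℕ) (y : ℂ)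
    (b : Fin q) {t : Fin (MR + ML)} (ht : (t : ℕ) + 1 = MR + ML) :
    D.detB S H Sbar n y b =
      (Matrix.of fun i j : Fin (MR + ML) => D.column Sbar (n - ML + j) i).cramer
        (D.kernelColumn S H Sbar (n - ML) y b) t := by
  rw [Matrix.cramer_apply, detB]
  congr 1
  ext i j
  have h : (j : ℕ) + 1 = MR + ML ↔ j = t := by
    rw [Fin.ext_iff]
    omega
  simp only [Matrix.of_apply, Matrix.updateCol_apply, h]

theorem cramer_kernelColumn (X : Matrix (Fin (MR + ML)) (Fin (MR + ML)) ℂ) (S : Matrix ℕ ℕ ℂ)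
    (H : ℕ → ℂ) (Sbar : Matrix ℕ ℕ ℂ) (m : ℕ) (y : ℂ) (b : Fin q) (t : Fin (MR + ML)) :
    X.cramer (D.kernelColumn S H Sbar m y b) t =
      ∑ j ∈ Finset.range m, X.cramer (D.column Sbar j) t * polyB q S H j y b +
      ∑ i, X.cramer (Pi.single (Fin.natAdd MR i) 1) t * (D.lleft i b / (y - D.lam i)) := by
  rw [kernelColumn_eq]
  simp only [map_add, map_sum, map_smul, Pi.add_apply, Finset.sum_apply, Pi.smul_apply,
    smul_eq_mul, mul_comm]

/-- Evaluation of the expansion of the left family of the perturbed problem. -/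
theorem evalVec_left_expansion [NeZero q] (hleft : ∀ i, D.lleft i ᵥ* evalAt D.L (D.lam i) = 0)
    (X : Matrix (Fin (MR + ML)) (Fin (MR + ML)) ℂ) (S : Matrix ℕ ℕ ℂ) (H : ℕ → ℂ)
    (Sbar : Matrix ℕ ℕ ℂ) (m : ℕ) (t : Fin (MR + ML)) {y : ℂ} (hy : ∀ i, y ≠ D.lam i)
    (b : Fin q) :
    evalVec y (∑ i, X.cramer (Pi.single (Fin.natAdd MR i) 1) t •
          quotientRow D.L (D.lam i) (D.lleft i) -
        ∑ j ∈ Finset.range m, X.cramer (D.column Sbar j) t •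
          mulVecMap D.Lᵀ ((H j)⁻¹ • rowFamily q S j)) b =
      -∑ b', X.cramer (D.kernelColumn S H Sbar m y b') t * evalAt D.L y b' b := by
  have h1 : ∀ i, evalVec y (quotientRow D.L (D.lam i) (D.lleft i)) b =
      -∑ b', D.lleft i b' / (y - D.lam i) * evalAt D.L y b' b := by
    intro i
    rw [evalVec_quotientRow (hleft i) (hy i), Pi.smul_apply, smul_eq_mul, ← neg_sub y, inv_neg,
      neg_mul, Matrix.vecMul, dotProduct, Finset.mul_sum]
    congr 1
    exact Finset.sum_congr rfl fun b' _ => by ring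
  have h2 : ∀ (k : ℂ) (j : ℕ), evalVec y (k • mulVecMap D.Lᵀ ((H j)⁻¹ • rowFamily q S j)) b =
      k * ∑ b', polyB q S H j y b' * evalAt D.L y b' b := by
    intro k j
    rw [map_smul, Pi.smul_apply, smul_eq_mul, mulVecMap_apply, Matrix.mulVec_transpose, evalVec_vecMul, evalVec_smul_rowFamily]
    rfl
  simp only [map_sub, map_sum, Pi.sub_apply, Finset.sum_apply, h2]
  simp only [map_smul, Pi.smul_apply, smul_eq_mul, h1, cramer_kernelColumn, add_mul, Finset.sum_add_distrib, Finset.sum_mul]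
  rw [Finset.sum_comm, Finset.sum_comm (s := Finset.univ) (t := Finset.univ)]
  simp only [mul_neg, Finset.sum_neg_distrib, Finset.mul_sum, mul_assoc]
  ring

theorem isDualPerturbation [NeZero p] [NeZero q] {NR r NL l : ℕ} (hμ : D.μ.HasMoments)
    (hoff : D.EigenvaluesOffSupport)
    (hR : RightNormalForm D.R NR r) (hL : LeftNormalForm D.L NL l)
    (hMR : MR + r = NR * p) (hML : ML + l = NL * q)
    (hrho : Function.Injective D.rho) (hlam : Function.Injective D.lam)
    (hΔ : ∀ i, ∀ x ∈ D.μ.supp, D.lam i ≠ (x : ℂ))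
    (hrleft : ∀ k, D.rleft k ≠ 0 ∧ D.rleft k ᵥ* evalAt D.R (D.rho k) = 0)
    (hlleft : ∀ i, D.lleft i ≠ 0 ∧ D.lleft i ᵥ* evalAt D.L (D.lam i) = 0)
    (hlright : ∀ i, evalAt D.L (D.lam i) *ᵥ D.lright i = 0)
    {I I' : Fin q → Fin p → ℂ[X] →ₗ[ℂ] ℂ}
    (hI : ∀ f : ℂ[X], ∀ b a, D.μ.functional (fun x => f.eval x) b a = I b a f)
    (hI' : ∀ f : ℂ[X], ∀ b a, D.perturbed (fun x => f.eval x) b a = I' b a f)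
    {Φ : (Fin p → ℂ[X]) →ₗ[ℂ] Fin (MR + ML) → ℂ}
    (hΦ : ∀ v, Φ v = Fin.append (fun k => D.rleft k ⬝ᵥ evalVec (D.rho k) v)
        (fun i => D.lleft i ⬝ᵥ (fun b => ∑ a, cint (D.μ b a)
            (fun x : ℝ => evalVec (x : ℂ) v a / (D.lam i - x))) -
          D.slope i * (D.xi i (D.lam i) ⬝ᵥ evalVec (D.lam i) v))) :
    IsDualPerturbation (monomialBasis q) (monomialBasis p) (matrixForm I) (matrixForm I') MR ML
      (mulVecMap D.R) (mulVecMap D.Lᵀ) Φ (fun i => quotientRow D.L (D.lam i) (D.lleft i)) where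
  shift_right := isMonicShift_mulVecMap hR hMR
  shift_left := isMonicShift_mulVecMap hL.transpose hML
  intertwine := matrixForm_intertwine hμ hoff hlright hI hI'
  functional_right v k := by
    rw [hΦ, Fin.append_left, mulVecMap_apply, evalVec_mulVec, Matrix.dotProduct_mulVec,
      (hrleft k).2, zero_dotProduct]
  functional_left v i := by
    rw [hΦ, Fin.append_right, mulVecMap_apply]
    exact (matrixForm_quotientRow hμ hoff hΔ hlam (fun i => (hlleft i).2) hlright hI' i v).symm
  functional_independent β h := by
    refine functionals_independent hrho (fun k => (hrleft k).1) fun v => ?_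
    simpa only [hΦ, Fin.append_left] using h v
  mem i := quotientRow_mem (isMonicShift_mulVecMap hL.transpose hML) (hlleft i).2
  independent _ h := quotientRow_independent (isMonicShift_mulVecMap hL.transpose hML) hlam
    (fun i => (hlleft i).1) (fun i => (hlleft i).2) h

end DualData

end MixedMOP

theorem mainTheorem5 {q p NR r NL l MR ML : ℕ} (D : DualData q p MR ML)
    -- the original matrix of measures
    (hμ : D.μ.HasMoments)
    -- the matrix polynomials, whose determinants have the degrees `MR` and `ML`
    (hR : RightNormalForm D.R NR r) (hL : LeftNormalForm D.L NL l)
    (hMR : MR + r = NR * p) (hML : ML + l = NL * q)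
    -- simple eigenvalues, with those of `L` off the support
    (hrho : ListsEigenvalues D.R D.rho) (hlam : ListsEigenvalues D.L D.lam)
    (hΔ : ∀ i, ∀ x ∈ D.μ.supp, D.lam i ≠ (x : ℂ))
    -- eigenvectors
    (hrleft : ∀ k, D.rleft k ≠ 0 ∧ Matrix.vecMul (D.rleft k) (evalAt D.R (D.rho k)) = 0)
    (hlleft : ∀ i, D.lleft i ≠ 0 ∧ Matrix.vecMul (D.lleft i) (evalAt D.L (D.lam i)) = 0)
    (hlright : ∀ i, D.lright i ≠ 0 ∧ Matrix.mulVec (evalAt D.L (D.lam i)) (D.lright i) = 0)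
    -- Gauss–Borel factorizations of the original and of the perturbed moment matrix
    {S Sbar S' Sbar' : Matrix ℕ ℕ ℂ} {H H' : ℕ → ℂ}
    (hM : IsGaussBorel (momentMatrix D.μ.functional) S H Sbar)
    (hM' : IsGaussBorel (momentMatrix D.perturbed) S' H' Sbar') :
    -- `L dμ̃ = dμ R`
    (∀ (f : Polynomial ℂ) (b : Fin q) (a : Fin p),
      ∑ b', D.perturbed (fun x => (D.L b b').eval x * f.eval x) b' a =
        ∑ a', D.μ.functional (fun x => f.eval x * (D.R a' a).eval x) b a') ∧
    ∀ n : ℕ, ML ≤ n →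
      D.tau Sbar n ≠ 0 ∧
      (1 ≤ n → 1 ≤ MR + ML → ∀ y : ℂ, (∀ i, y ≠ D.lam i) → ∀ b : Fin q,
        polyB q S' H' (n - 1) y b =
          -∑ b', D.detB S H Sbar n y b' * (evalAt D.L y b' b / D.tau Sbar n)) ∧
      (∀ x : ℂ, (∀ k, x ≠ D.rho k) → ∀ a : Fin p,
        polyA p Sbar' n x a =
          1 / D.tau Sbar n * ∑ a', (evalAt D.R x)⁻¹ a a' * D.detA Sbar n x a') := by
  have : NeZero p := ⟨(Nat.zero_lt_of_lt hR.lt).ne'⟩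
  have : NeZero q := ⟨(Nat.zero_lt_of_lt hL.lt).ne'⟩
  have hoff : D.EigenvaluesOffSupport := by
    intro z hz
    obtain ⟨i, rfl⟩ := (hlam.2 z).1 hz
    exact hΔ i
  obtain ⟨I, hI⟩ := DualData.exists_functional hμ
  obtain ⟨I', hI'⟩ := DualData.exists_perturbed hμ hoff
  obtain ⟨Φ, hΦ⟩ := DualData.exists_column hμ hΔ
  have hd := DualData.isDualPerturbation hμ hoff hR hL hMR hML hrho.1 hlam.1 hΔ hrleft hlleft
    (fun i => (hlright i).2) hI hI' hΦ
  have hb := hM.isBiorthogonal hI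
  have hb' := hM'.isBiorthogonal hI'
  have hcol := DualData.column_eq hΦ Sbar
  refine ⟨DualData.perturbed_relation hμ hoff fun i => (hlright i).2, fun n hn => ?_⟩
  have hX : IsDualPerturbation.columnMatrix Φ (rowFamily p Sbar) (n - ML) =
      Matrix.of fun i j : Fin (MR + ML) => D.column Sbar (n - ML + j) i := by
    ext i j
    rw [IsDualPerturbation.columnMatrix, Matrix.of_apply, hcol, Matrix.of_apply]
  have htau := hd.det_columnMatrix_ne_zero hb hb' (n - ML)
  rw [hX] at htau
  refine ⟨htau, fun h1 h2 y hy b => ?_, fun x hx a => ?_⟩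
  -- The slot t is the last column, which exists because M^R + M^L ≥ 1; n ≥ 1 makes n - 1 a genuine
  -- predecessor.
  · have ht : ((⟨MR + ML - 1, by omega⟩ : Fin (MR + ML)) : ℕ) + 1 = MR + ML :=
      Nat.sub_add_cancel h2
    have h := congrArg (fun w => evalVec y w b)
      (hd.det_smul_left hb hb' (m := n - ML) (n := n - 1) (by omega) ht)
    simp only [hX, hcol] at h
    rw [DualData.evalVec_left_expansion (fun i => (hlleft i).2) _ _ _ _ _ _ hy, map_smul,
      evalVec_smul_rowFamily, Pi.smul_apply, smul_eq_mul] at h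
    simp only [← DualData.detB_eq_cramer S H Sbar n y _ ht] at h
    rw [← mul_right_inj' htau, h, mul_neg, Finset.mul_sum]
    congr 1
    refine Finset.sum_congr rfl fun b' _ => ?_
    change _ = D.tau Sbar n * _
    change D.tau Sbar n ≠ 0 at htau
    field_simp
  · have hdet : IsUnit (evalAt D.R x).det := by
      rw [det_evalAt, isUnit_iff_ne_zero]
      intro h
      obtain ⟨k, hk⟩ := (hrho.2 x).1 h
      exact hx k hk.symm
    -- The bordered determinants give R(x) Ã_n(x) entry by entry, and R(x) is invertible away from
    -- the ρ_k.
    have hA : ∀ a', D.detA Sbar n x a' =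
        D.tau Sbar n * (evalAt D.R x *ᵥ polyA p Sbar' n x) a' := by
      intro a'
      have h := hd.det_bordered hb hb' (n - ML) (LinearMap.proj a' ∘ₗ evalVec x)
      simp only [hX, hcol, LinearMap.comp_apply, LinearMap.proj_apply, evalVec_rowFamily,
        mulVecMap_apply, evalVec_mulVec, Nat.sub_add_cancel hn] at h
      exact h
    have h : polyA p Sbar' n x = (evalAt D.R x)⁻¹ *ᵥ (evalAt D.R x *ᵥ polyA p Sbar' n x) := by
      rw [Matrix.mulVec_mulVec, Matrix.nonsing_inv_mul _ hdet, Matrix.one_mulVec]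
    conv_lhs => rw [h]
    rw [Matrix.mulVec, dotProduct, Finset.mul_sum]
    refine Finset.sum_congr rfl fun a' _ => ?_
    rw [hA]
    change D.tau Sbar n ≠ 0 at htau
    field_simp
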